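/- Theorem (Existence of quasimodes with bounded frequencies). Let $Q_1,Q_2,R_z>0$, let $a=\sqrt{Q_1Q_2}/R_z$, and let $g$ be the two charge microstate metric in coordinates $(t,z,r,\theta,\phi,\psi)$, $r\ge 0$, $0\le\theta\le\pi/2$, with $\phi,\psi$ of period $2\pi$ and $z$ of period $2\pi R_z$: $$g=-\tfrac1h(dt^2-dz^2)+hf\Big(d\theta^2+\tfrac{dr^2}{r^2+a^2}\Big)-\tfrac{2a\sqrt{Q_1Q_2}}{hf}\big(\cos^2\theta\,dz\,d\psi+\sin^2\theta\,dt\,d\phi\big)$$ $$\qquad+h\Big(r^2+\tfrac{a^2Q_1Q_2\cos^2\theta}{h^2f^2}\Big)\cos^2\theta\,d\psi^2+h\Big(r^2+a^2-\tfrac{a^2Q_1Q_2\sin^2\theta}{h^2f^2}\Big)\sin^2\theta\,d\phi^2,$$ where $f=r^2+a^2\cos^2\theta$ and $h=\sqrt{(1+Q_1/f)(1+Q_2/f)}$. For $\omega,\lambda\in\mathbb R$ and $\ell\in\mathbb N$ let $\mu_\ell^2=\mu_\ell(\omega,\lambda)^2$ be the angular eigenvalue labelled by $\ell$, that is, the lowest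 eigenvalue of $$-\frac1{\sin2\theta}\frac{d}{d\theta}\Big(\sin2\theta\,\frac{du_\theta}{d\theta}\Big)+\Big(\frac{m_\phi^2}{\sin^2\theta}+(\lambda^2-\omega^2)a^2\cos^2\theta\Big)u_\theta=\mu_\ell^2\,u_\theta,\qquad m_\phi=-\ell,$$ on $(0,\pi/2)$, with $u_\theta$ regular at both end points (i.e. $e^{im_\phi\phi}u_\theta(\theta)$ is smooth on the unit $3$-sphere with Hopf coordinates $\theta,\phi,\psi$). Let $\lambda\in\mathbb R$ with $\lambda R_z\in\mathbb Z$. There are constants $\omega_0$ and $C$, depending only on $Q_1,Q_2,R_z,\lambda$, such that for every $\omega_{\max}\ge\omega_0$ and every $R>0$ the following holds for all sufficiently large integers $\ell$. There are $\omega\in\mathbb R$ with $|\omega|\le\omega_{\max}$ (so the frequency does not scale with $\ell$), $\mu_\ell=\mu_\ell(\omega,\lambda)>0$ with $$\big|\ell-(\mu_\ell-1)\big|\le \frac{C}{\mu_\ell},\qquad\text{i.e. } \ell=\mu_\ell-1+O(\mu_\ell^{-1}),$$ a corresponding angular eigenfunction $u_\theta$, and a real function $u_r$, neither of them identically zero,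 such that, with $m_\psi=0$ and $m_\phi=-\ell$, the mode $$u=e^{-i\omega t+i\lambda z+im_\psi\psi+im_\phi\phi}\,u_r(r)\,u_\theta(\theta)$$ solves $\Box_g u=0$ for $0<r<R\mu_\ell$, $0<\theta<\pi/2$, satisfies the Dirichlet condition $u_r(R\mu_\ell)=0$, and is regular at $r=0$: $u$ is a smooth function on the region $r\le R\mu_\ell$ of the spacetime manifold (including $r=0$, where the circle generated by $\partial_z+R_z^{-1}\partial_\psi$ smoothly shrinks to a point, and the axes $\theta=0,\pi/2$). -/

import Mathlib

noncomputable section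

namespace Microstate

/-- The parameter `a = √(Q₁ Q₂) / R_z`. -/
def rot (Q₁ Q₂ Rz : ℝ) : ℝ := Real.sqrt (Q₁ * Q₂) / Rz

/-- The function `f = r² + a² cos² θ`. -/
def fFun (Q₁ Q₂ Rz r θ : ℝ) : ℝ := r ^ 2 + (rot Q₁ Q₂ Rz) ^ 2 * Real.cos θ ^ 2

/-- The function `h = √((1 + Q₁ / f) (1 + Q₂ / f))`. -/
def hFun (Q₁ Q₂ Rz r θ : ℝ) : ℝ :=
  Real.sqrt ((1 + Q₁ / fFun Q₁ Q₂ Rz r θ) * (1 + Q₂ / fFun Q₁ Q₂ Rz r θ))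

/-- The components of the two charge microstate metric in the coordinates
`x = (t, z, r, θ, φ, ψ)`, valid where `0 < r` and `0 < θ < π / 2`. -/
def metric (Q₁ Q₂ Rz : ℝ) (x : Fin 6 → ℝ) : Matrix (Fin 6) (Fin 6) ℝ :=
  let r := x 2
  let θ := x 3
  let a := rot Q₁ Q₂ Rz
  let f := fFun Q₁ Q₂ Rz r θ
  let h := hFun Q₁ Q₂ Rz r θ
  let gtt := -(1 / h)
  let gzz := 1 / h
  let grr := h * f / (r ^ 2 + a ^ 2)
  let gθθ := h * f
  let gtφ := -(a * Real.sqrt (Q₁ * Q₂) / (h * f) * Real.sin θ ^ 2)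
  let gzψ := -(a * Real.sqrt (Q₁ * Q₂) / (h * f) * Real.cos θ ^ 2)
  let gφφ := h * (r ^ 2 + a ^ 2 - a ^ 2 * Q₁ * Q₂ * Real.sin θ ^ 2 / (h ^ 2 * f ^ 2))
    * Real.sin θ ^ 2
  let gψψ := h * (r ^ 2 + a ^ 2 * Q₁ * Q₂ * Real.cos θ ^ 2 / (h ^ 2 * f ^ 2))
    * Real.cos θ ^ 2
  !![gtt, 0,   0,   0,   gtφ, 0;
     0,   gzz, 0,   0,   0,   gzψ;
     0,   0,   grr, 0,   0,   0;
     0,   0,   0,   gθθ, 0,   0;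
     gtφ, 0,   0,   0,   gφφ, 0;
     0,   gzψ, 0,   0,   0,   gψψ]

/-- The partial derivative of `u` in the `i`-th coordinate at `x`. -/
def partialDeriv {n : ℕ} (i : Fin n) (u : (Fin n → ℝ) → ℂ) (x : Fin n → ℝ) : ℂ :=
  deriv (fun s : ℝ => u (Function.update x i s)) (x i)

/-- The wave operator (Laplace-Beltrami operator) of a metric given in coordinates:
`□_g u = |det g|^{-1/2} ∂_μ (|det g|^{1/2} g^{μν} ∂_ν u)`. -/
def waveOp {n : ℕ} (g : (Fin n → ℝ) → Matrix (Fin n) (Fin n) ℝ) (u : (Fin n → ℝ) → ℂ)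
    (x : Fin n → ℝ) : ℂ :=
  ((Real.sqrt |(g x).det| : ℝ) : ℂ)⁻¹ *
    ∑ i, partialDeriv i
      (fun y => ((Real.sqrt |(g y).det| : ℝ) : ℂ) *
        ∑ j, (((g y)⁻¹ i j : ℝ) : ℂ) * partialDeriv j u y) x

/-- The separated function
`e^{-iωt + iλz + i m_ψ ψ + i m_φ φ} u_r(r) u_θ(θ)` of `x = (t, z, r, θ, φ, ψ)`. -/
def mode (ω lam : ℝ) (mφ mψ : ℤ) (ur uθ : ℝ → ℝ) (x : Fin 6 → ℝ) : ℂ :=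
  Complex.exp (Complex.I *
      ((-(ω * x 0) + lam * x 1 + (mψ : ℝ) * x 5 + (mφ : ℝ) * x 4 : ℝ) : ℂ)) *
    ((ur (x 2) : ℝ) : ℂ) * ((uθ (x 3) : ℝ) : ℂ)

/-- The map from the coordinates `(t, z, r, θ, φ, ψ)` onto the spacetime manifold
`ℝ × ℝ² × S³ ⊆ ℝ × ℂ × (ℂ × ℂ)`. At `r = 0` it is the orbit of `∂_z + (1 / R_z) ∂_ψ` (which has
period `2 π R_z`) that shrinks to a point, so that `ψ - z / R_z` is the angle that stays
regular there; the last two components are Hopf coordinates on the unit `S³`. -/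
def globalCoord (Rz : ℝ) (x : Fin 6 → ℝ) : ℝ × ℂ × ℂ × ℂ :=
  (x 0,
   (x 2 : ℂ) * Complex.exp (Complex.I * ((x 1 / Rz : ℝ) : ℂ)),
   ((Real.sin (x 3) : ℝ) : ℂ) * Complex.exp (Complex.I * (x 4 : ℂ)),
   ((Real.cos (x 3) : ℝ) : ℂ) * Complex.exp (Complex.I * ((x 5 - x 1 / Rz : ℝ) : ℂ)))

/-- The coordinate expression `u` is that of a smooth function on the region `r ≤ r₁` of the
spacetime manifold: smooth up to the boundary `r = r₁`, and regular at `r = 0` and on the axes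
`θ = 0` and `θ = π / 2`. As the region is a closed subset of a closed submanifold of
`ℝ × ℂ × ℂ × ℂ`, the smooth functions on it are the restrictions of smooth functions. -/
def RegularUpTo (Rz r₁ : ℝ) (u : (Fin 6 → ℝ) → ℂ) : Prop :=
  ∃ U : ℝ × ℂ × ℂ × ℂ → ℂ, ContDiff ℝ ((⊤ : ℕ∞) : WithTop ℕ∞) U ∧
    ∀ x : Fin 6 → ℝ, 0 ≤ x 2 → x 2 ≤ r₁ → 0 ≤ x 3 → x 3 ≤ Real.pi / 2 →
      u x = U (globalCoord Rz x)

/-- `v` is a (regular, nontrivial) eigenfunction, with eigenvalue `Λ`, of the angular equation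
with azimuthal number `m_φ = m` (and `m_ψ = 0`). Regularity at the end points means that
`e^{imφ} v(θ)` is a smooth function on the unit `S³ ⊆ ℂ × ℂ`. -/
def IsAngularEigenfunction (Q₁ Q₂ Rz lam ω : ℝ) (m : ℤ) (Λ : ℝ) (v : ℝ → ℝ) : Prop :=
  (∃ θ ∈ Set.Ioo 0 (Real.pi / 2), v θ ≠ 0) ∧
  (∃ G : ℂ × ℂ → ℂ, ContDiff ℝ ((⊤ : ℕ∞) : WithTop ℕ∞) G ∧
    ∀ θ ∈ Set.Icc 0 (Real.pi / 2), ∀ φ ψ : ℝ,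
      Complex.exp (Complex.I * (((m : ℝ) * φ : ℝ) : ℂ)) * ((v θ : ℝ) : ℂ) =
        G (((Real.sin θ : ℝ) : ℂ) * Complex.exp (Complex.I * (φ : ℂ)),
           ((Real.cos θ : ℝ) : ℂ) * Complex.exp (Complex.I * (ψ : ℂ)))) ∧
  ∀ θ ∈ Set.Ioo 0 (Real.pi / 2),
    -(1 / Real.sin (2 * θ)) * deriv (fun s => Real.sin (2 * s) * deriv v s) θ +
      ((m : ℝ) ^ 2 / Real.sin θ ^ 2 +
        (lam ^ 2 - ω ^ 2) * (rot Q₁ Q₂ Rz) ^ 2 * Real.cos θ ^ 2) * v θ = Λ * v θ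

/-- `Λ` is the angular eigenvalue labelled by `ℓ`, i.e. the lowest eigenvalue of the angular
equation with `m_φ = -ℓ`, `m_ψ = 0`. When `λ² = ω²` it is `ℓ (ℓ + 2)`, with eigenfunction
`sin^ℓ θ`. -/
def IsAngularEigenvalue (Q₁ Q₂ Rz lam ω : ℝ) (ℓ : ℕ) (Λ : ℝ) : Prop :=
  IsLeast {Λ' : ℝ | ∃ v, IsAngularEigenfunction Q₁ Q₂ Rz lam ω (-(ℓ : ℤ)) Λ' v} Λ

/-- `u_r`, `u_θ` give a nontrivial mode solution of the wave equation, of frequency `ω` and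
momenta `λ`, `m_φ`, `m_ψ`, in `0 ≤ r ≤ r₁`, with Dirichlet condition at `r = r₁` and regular
at `r = 0`. -/
structure IsDirichletMode (Q₁ Q₂ Rz r₁ ω lam : ℝ) (mφ mψ : ℤ) (ur uθ : ℝ → ℝ) : Prop where
  nontrivial_r : ∃ r ∈ Set.Ioo 0 r₁, ur r ≠ 0
  nontrivial_θ : ∃ θ ∈ Set.Ioo 0 (Real.pi / 2), uθ θ ≠ 0
  regular : RegularUpTo Rz r₁ (mode ω lam mφ mψ ur uθ)
  wave : ∀ x : Fin 6 → ℝ, 0 < x 2 → x 2 < r₁ → 0 < x 3 → x 3 < Real.pi / 2 →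
    waveOp (metric Q₁ Q₂ Rz) (mode ω lam mφ mψ ur uθ) x = 0
  dirichlet : ur r₁ = 0

end Microstate

end

/-!
With `m_ψ = 0` and `m_φ = -ℓ` the wave equation separates (`waveOp_mode_eq_zero`). Put `k = |λ|
R_z`, an integer, and `Q = Q₁ + Q₂`. In the variables `x = cos² θ` and `s = r²` the substitutions
`u_θ = sin^ℓ θ · y(x)` and `u_r = r^k w(s)` turn the two equations into

* `(x (1 - x)^(ℓ+1) y')' = (1 - x)^ℓ (κ x - δ) / 4 · y`, with `κ = (λ² - ω²) a²` and eigenvalue `Λ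
  = μ² = ℓ (ℓ + 2) + δ`;
* `(s^(k+1) (s + a²) w')' = s^k q w`, with `4 q = Λ - (ω² - λ²) (s + Q) - a² (ω R_z + ℓ)² / (s +
  a²) - k (k + 2)`.

Regularity of the mode on the spacetime manifold is smoothness of `y` and `w`. Solutions regular
at a singular end point exist, are smooth and depend continuously on parameters, because the
singular equation is equivalent to `w' = ρ ∫₀¹ x^k q(s x) w(s x) dx` with `ρ` smooth
(`regularSol`).

*Angular equation.* For large `ℓ` the solutions regular at the two end points stay positive up to
`x = 1 / (2 (ℓ + 1))`, and their Wronskian there changes sign for `δ ∈ [-|κ|, |κ|]`; this gives a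
positive eigenfunction with `|δ| ≤ |κ|` (`exists_angular_ground_state`). Picone's identity
(`IsAngularProfile.not_forall_potential_lt`) shows that its eigenvalue is the lowest one and that
`δ` is a Lipschitz function of `κ`. As `(ℓ + 1)² - μ² = 1 - δ` is bounded, `μ - 1 - ℓ = O(1 / μ)`.

*Radial equation.* At `ω = 0` one has `q ≥ 0`, so the regular solution `w` has no zero. Near `r =
0` the operator is a two-dimensional harmonic oscillator of frequency of order `ℓ`, and the cross
term `2 ω R_z ℓ` of the centrifugal potential lowers the energy by an amount of the same order. A
fixed large `ω₀` therefore makes the well `s ≤ a² / ℓ` deep enough that `w` must vanish in it, by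
Sturm comparison with `(a² / ℓ - s)²` (`not_pos_of_well`). Zeros of `w` are simple, so they can
appear only at the boundary `s = R² μ²` when `ω` moves from `0` to `ω₀`: for some `ω ∈ [0, ω₀]`
the solution `w` vanishes exactly there (`exists_radial_dirichlet`).
-/

open Set Filter Topology

namespace Microstate

/-! ### Weighted averages along a segment -/

/-- The weighted radial average `∫₀¹ xᵏ f(s x) dx`. For `s ≠ 0` it is
`s^(-(k+1)) ∫₀ˢ τᵏ f(τ) dτ`, but in this form it is manifestly smooth at `s = 0`. -/
noncomputable def radialAvg (k : ℕ) (f : ℝ → ℝ) (s : ℝ) : ℝ :=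
  ∫ x in (0 : ℝ)..1, x ^ k * f (s * x)

theorem pow_mul_radialAvg (k : ℕ) (f : ℝ → ℝ) (s : ℝ) :
    s ^ (k + 1) * radialAvg k f s = ∫ τ in (0 : ℝ)..s, τ ^ k * f τ := by
  have h := intervalIntegral.mul_integral_comp_mul_left (a := 0) (b := 1)
    (f := fun τ : ℝ => τ ^ k * f τ) s
  simp only [mul_zero, mul_one] at h
  rw [← h, radialAvg, pow_succ', mul_assoc, ← intervalIntegral.integral_const_mul]
  congr 1
  refine intervalIntegral.integral_congr fun x _ => ?_
  simp only [mul_pow]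
  ring

theorem hasDerivAt_pow_mul_radialAvg (k : ℕ) {f : ℝ → ℝ} (hf : Continuous f) (s : ℝ) :
    HasDerivAt (fun s => s ^ (k + 1) * radialAvg k f s) (s ^ k * f s) s := by
  have h : (fun s => s ^ (k + 1) * radialAvg k f s) = fun s => ∫ τ in (0 : ℝ)..s, τ ^ k * f τ :=
    funext fun s => pow_mul_radialAvg k f s
  rw [h]
  have hc : Continuous fun τ : ℝ => τ ^ k * f τ := by fun_prop
  exact intervalIntegral.integral_hasDerivAt_right (hc.intervalIntegrable _ _)
    (hc.stronglyMeasurableAtFilter _ _) hc.continuousAt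

theorem abs_radialAvg_le (k n : ℕ) {f : ℝ → ℝ} (hf : Continuous f) {s C : ℝ}
    (h : ∀ x ∈ Icc (0 : ℝ) 1, |f (s * x)| ≤ C * x ^ n) :
    |radialAvg k f s| ≤ C / (n + k + 1) := by
  have h1 : |radialAvg k f s| ≤ ∫ x in (0 : ℝ)..1, |x ^ k * f (s * x)| :=
    intervalIntegral.abs_integral_le_integral_abs zero_le_one
  refine h1.trans ?_
  have h2 : (∫ x in (0 : ℝ)..1, |x ^ k * f (s * x)|) ≤ ∫ x in (0 : ℝ)..1, C * x ^ (n + k) := by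
    apply intervalIntegral.integral_mono_on zero_le_one
    · exact Continuous.intervalIntegrable (by fun_prop) _ _
    · exact Continuous.intervalIntegrable (by fun_prop) _ _
    · intro x hx
      rw [abs_mul, abs_of_nonneg (pow_nonneg hx.1 k), pow_add, mul_comm (x ^ k), ← mul_assoc]
      exact mul_le_mul_of_nonneg_right (h x hx) (pow_nonneg hx.1 k)
  refine h2.trans (le_of_eq ?_)
  rw [intervalIntegral.integral_const_mul, integral_pow]
  push_cast
  simp [div_eq_mul_inv]

theorem radialAvg_nonneg (k : ℕ) {f : ℝ → ℝ} {s : ℝ} (h : ∀ x ∈ Icc (0 : ℝ) 1, 0 ≤ f (s * x)) :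
    0 ≤ radialAvg k f s :=
  intervalIntegral.integral_nonneg zero_le_one fun x hx =>
    mul_nonneg (pow_nonneg hx.1 k) (h x hx)

theorem continuous_radialAvg_uncurry (k : ℕ) {f : ℝ → ℝ → ℝ}
    (hf : Continuous (Function.uncurry f)) :
    Continuous (Function.uncurry fun p s => radialAvg k (f p) s) := by
  refine intervalIntegral.continuous_parametric_intervalIntegral_of_continuous'
    (f := fun (z : ℝ × ℝ) x => x ^ k * f z.1 (z.2 * x)) ?_ 0 1
  have : Continuous fun z : (ℝ × ℝ) × ℝ => Function.uncurry f (z.1.1, z.1.2 * z.2) :=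
    hf.comp (by fun_prop)
  exact (by fun_prop : Continuous fun z : (ℝ × ℝ) × ℝ => z.2 ^ k).mul this

theorem continuous_radialAvg (k : ℕ) {f : ℝ → ℝ} (hf : Continuous f) :
    Continuous (radialAvg k f) :=
  (continuous_radialAvg_uncurry k (f := fun _ => f) (hf.comp continuous_snd)).comp
    (by fun_prop : Continuous fun s : ℝ => ((0 : ℝ), s))

theorem hasDerivAt_radialAvg (k : ℕ) {f : ℝ → ℝ} (hf : ContDiff ℝ 1 f) (s : ℝ) :
    HasDerivAt (radialAvg k f) (radialAvg (k + 1) (deriv f) s) s := by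
  have hf' : Continuous (deriv f) := hf.continuous_deriv le_rfl
  obtain ⟨C, hC⟩ := (isCompact_Icc (a := -(|s| + 1)) (b := |s| + 1)).exists_bound_of_continuousOn
    hf'.continuousOn
  refine (intervalIntegral.hasDerivAt_integral_of_dominated_loc_of_deriv_le
    (F := fun s x => x ^ k * f (s * x)) (F' := fun s x => x ^ (k + 1) * deriv f (s * x))
    (bound := fun _ => C) (s := Metric.ball s 1) (Metric.ball_mem_nhds s one_pos)
    ?_ ?_ ?_ ?_ ?_ ?_).2
  · exact Eventually.of_forall fun t => by
      have := hf.continuous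
      exact Continuous.aestronglyMeasurable (by fun_prop)
  · have := hf.continuous
    exact Continuous.intervalIntegrable (by fun_prop) _ _
  · exact Continuous.aestronglyMeasurable (by fun_prop)
  · refine Eventually.of_forall fun x hx t ht => ?_
    rw [uIoc_of_le zero_le_one] at hx
    have ht' : |t| ≤ |s| + 1 := by
      have := abs_sub_abs_le_abs_sub t s
      rw [Metric.mem_ball, Real.dist_eq] at ht
      linarith
    have htx : |t * x| ≤ |s| + 1 := by
      rw [abs_mul, abs_of_pos hx.1]
      exact (mul_le_of_le_one_right (abs_nonneg _) hx.2).trans ht'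
    rw [norm_mul, norm_pow, Real.norm_of_nonneg hx.1.le]
    have h1 := hC (t * x) (abs_le.mp htx)
    exact (mul_le_of_le_one_left (norm_nonneg _) (pow_le_one₀ hx.1.le hx.2)).trans h1
  · exact intervalIntegrable_const
  · refine Eventually.of_forall fun x _ t _ => ?_
    have h1 : HasDerivAt f (deriv f (t * x)) (t * x) :=
      (hf.differentiable (by norm_num)).differentiableAt.hasDerivAt
    have h2 : HasDerivAt (fun t : ℝ => t * x) x t := by
      simpa using (hasDerivAt_id t).mul_const x
    have h3 := (h1.comp t h2).const_mul (x ^ k)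
    refine h3.congr_deriv ?_
    ring

theorem contDiff_radialAvg (n : ℕ) : ∀ (k : ℕ) {f : ℝ → ℝ}, ContDiff ℝ n f →
    ContDiff ℝ n (radialAvg k f) := by
  induction n with
  | zero => intro k f hf; exact contDiff_zero.2 (continuous_radialAvg k (contDiff_zero.1 hf))
  | succ n ih =>
    intro k f hf
    have h1 : ContDiff ℝ 1 f := hf.of_le (by norm_cast; omega)
    have hd : deriv (radialAvg k f) = radialAvg (k + 1) (deriv f) :=
      funext fun s => (hasDerivAt_radialAvg k h1 s).deriv
    have h2 : ContDiff ℝ ((n : WithTop ℕ∞) + 1) f := by exact_mod_cast hf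
    have h3 : ContDiff ℝ ((n : WithTop ℕ∞) + 1) (radialAvg k f) := by
      rw [contDiff_succ_iff_deriv] at h2 ⊢
      refine ⟨fun s => (hasDerivAt_radialAvg k h1 s).differentiableAt, by simp, ?_⟩
      rw [hd]
      exact ih (k + 1) h2.2.2
    exact_mod_cast h3

theorem hasSum_radialAvg (k : ℕ) {F : ℕ → ℝ → ℝ} {f : ℝ → ℝ} {b : ℕ → ℝ} {s : ℝ}
    (hF : ∀ n, Continuous (F n)) (hb : Summable b)
    (hFb : ∀ n, ∀ x ∈ Icc (0 : ℝ) 1, |F n (s * x)| ≤ b n)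
    (hsum : ∀ x ∈ Icc (0 : ℝ) 1, HasSum (fun n => F n (s * x)) (f (s * x))) :
    HasSum (fun n => radialAvg k (F n) s) (radialAvg k f s) := by
  refine intervalIntegral.hasSum_integral_of_dominated_convergence (fun n _ => b n) ?_ ?_ ?_ ?_ ?_
  · intro n
    have := hF n
    exact Continuous.aestronglyMeasurable (by fun_prop)
  · refine fun n => Eventually.of_forall fun x hx => ?_
    rw [uIoc_of_le zero_le_one] at hx
    rw [norm_mul, norm_pow, Real.norm_of_nonneg hx.1.le]
    exact (mul_le_of_le_one_left (norm_nonneg _) (pow_le_one₀ hx.1.le hx.2)).trans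
      (hFb n x ⟨hx.1.le, hx.2⟩)
  · exact Eventually.of_forall fun _ _ => hb
  · exact intervalIntegrable_const
  · refine Eventually.of_forall fun x hx => ?_
    rw [uIoc_of_le zero_le_one] at hx
    exact (hsum x ⟨hx.1.le, hx.2⟩).mul_left _

/-! ### Regular solutions at a singular end point -/

/-- The terms of the Picard series of the singular initial value problem
`w' = ρ · radialAvg k (q_p w)`, `w(0) = 1`, where `p` is a parameter. -/
noncomputable def picardTerm (k : ℕ) (ρ : ℝ → ℝ) (q : ℝ → ℝ → ℝ) : ℕ → ℝ → ℝ → ℝ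
  | 0 => fun _ _ => 1
  | n + 1 => fun p s => s * radialAvg 0
      (fun σ => ρ σ * radialAvg k (fun τ => q p τ * picardTerm k ρ q n p τ) σ) s

/-- The solution of `w' = ρ · radialAvg k (q_p w)`, `w(0) = 1`. Where `ρ P = 1` it is the solution
of `(s^(k+1) P w')' = s^k q_p w` that is regular at the singular point `s = 0`. -/
noncomputable def regularSol (k : ℕ) (ρ : ℝ → ℝ) (q : ℝ → ℝ → ℝ) (p s : ℝ) : ℝ :=
  ∑' n, picardTerm k ρ q n p s

section

variable {k : ℕ} {ρ : ℝ → ℝ} {q : ℝ → ℝ → ℝ}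

theorem continuous_picardTerm (hρ : Continuous ρ) (hq : Continuous (Function.uncurry q)) (n : ℕ) :
    Continuous (Function.uncurry (picardTerm k ρ q n)) := by
  induction n with
  | zero => exact continuous_const
  | succ n ih =>
    have h1 := continuous_radialAvg_uncurry k
      (f := fun p τ => q p τ * picardTerm k ρ q n p τ) (hq.mul ih)
    have h2 := continuous_radialAvg_uncurry 0
      (f := fun p σ => ρ σ * radialAvg k (fun τ => q p τ * picardTerm k ρ q n p τ) σ)
      ((hρ.comp continuous_snd).mul h1)
    exact continuous_snd.mul h2

theorem abs_mul_le_of_mem_Icc {s x : ℝ} (hx : x ∈ Icc (0 : ℝ) 1) : |s * x| ≤ |s| := by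
  rw [abs_mul, abs_of_nonneg hx.1]
  exact mul_le_of_le_one_right (abs_nonneg _) hx.2

theorem abs_picardTerm_le (hρ : Continuous ρ) (hq : Continuous (Function.uncurry q))
    {p S A B : ℝ} (hA : ∀ s, |s| ≤ S → |ρ s| ≤ A) (hB : ∀ s, |s| ≤ S → |q p s| ≤ B) (n : ℕ) :
    ∀ s, |s| ≤ S → |picardTerm k ρ q n p s| ≤ (A * B * |s|) ^ n / n.factorial := by
  have hc : ∀ n, Continuous (picardTerm k ρ q n p) := fun n =>
    (continuous_picardTerm hρ hq n).comp (by fun_prop : Continuous fun s : ℝ => (p, s))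
  have hqc : Continuous (q p) := hq.comp (by fun_prop : Continuous fun s : ℝ => (p, s))
  induction n with
  | zero => intro s _; simp [picardTerm]
  | succ n ih =>
    intro s hs
    have hA0 : 0 ≤ A := (abs_nonneg _).trans (hA s hs)
    have hB0 : 0 ≤ B := (abs_nonneg _).trans (hB s hs)
    have hinner : ∀ σ, |σ| ≤ S → |radialAvg k (fun τ => q p τ * picardTerm k ρ q n p τ) σ| ≤
        B * ((A * B * |σ|) ^ n / n.factorial) := by
      intro σ hσ
      have h := abs_radialAvg_le k 0 (hqc.mul (hc n)) (s := σ)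
        (C := B * ((A * B * |σ|) ^ n / n.factorial)) (fun x hx => by
          rw [pow_zero, mul_one, Pi.mul_apply, abs_mul]
          have hx' := abs_mul_le_of_mem_Icc (s := σ) hx
          refine mul_le_mul (hB _ (hx'.trans hσ)) ((ih _ (hx'.trans hσ)).trans ?_)
            (abs_nonneg _) hB0
          gcongr)
      refine h.trans (div_le_self (by positivity) ?_)
      push_cast
      linarith [(Nat.cast_nonneg k : (0 : ℝ) ≤ k)]
    have houter := abs_radialAvg_le 0 n
      (hρ.mul (continuous_radialAvg k (hqc.mul (hc n)))) (s := s)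
      (C := A * (B * ((A * B * |s|) ^ n / n.factorial))) (fun x hx => by
        have hx' := (abs_mul_le_of_mem_Icc (s := s) hx).trans hs
        rw [Pi.mul_apply, abs_mul]
        refine (mul_le_mul (hA _ hx') (hinner _ hx') (abs_nonneg _) hA0).trans (le_of_eq ?_)
        rw [abs_mul, abs_of_nonneg hx.1]
        simp only [mul_pow]
        ring)
    simp only [picardTerm, abs_mul]
    refine (mul_le_mul_of_nonneg_left houter (abs_nonneg s)).trans (le_of_eq ?_)
    rw [Nat.factorial_succ, pow_succ]
    have h1 : (n.factorial : ℝ) ≠ 0 := by positivity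
    have h2 : (n : ℝ) + 1 ≠ 0 := by positivity
    push_cast
    field_simp
    ring

theorem exists_picardTerm_bound (hρ : Continuous ρ) (hq : Continuous (Function.uncurry q))
    (p₀ S : ℝ) : ∃ b : ℕ → ℝ, Summable b ∧
      ∀ n p s, |p - p₀| ≤ 1 → |s| ≤ S → |picardTerm k ρ q n p s| ≤ b n := by
  obtain ⟨A, hA⟩ := (isCompact_Icc (a := -S) (b := S)).exists_bound_of_continuousOn
    hρ.continuousOn
  obtain ⟨B, hB⟩ := ((isCompact_Icc (a := p₀ - 1) (b := p₀ + 1)).prod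
    (isCompact_Icc (a := -S) (b := S))).exists_bound_of_continuousOn hq.continuousOn
  refine ⟨_, Real.summable_pow_div_factorial (|A| * |B| * |S|), fun n p s hp hs => ?_⟩
  have hp' := abs_le.mp hp
  refine (abs_picardTerm_le hρ hq (S := S) (A := |A|) (B := |B|)
    (fun s hs => (hA s (abs_le.mp hs)).trans (le_abs_self _))
    (fun s hs => (hB (p, s) ⟨⟨by linarith, by linarith⟩, abs_le.mp hs⟩).trans
      (le_abs_self _)) n s hs).trans ?_
  have : |s| ≤ |S| := hs.trans (le_abs_self _)
  gcongr

theorem continuous_regularSol (hρ : Continuous ρ) (hq : Continuous (Function.uncurry q)) :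
    Continuous (Function.uncurry (regularSol k ρ q)) := by
  rw [continuous_iff_continuousAt]
  rintro ⟨p₀, s₀⟩
  obtain ⟨b, hb, hbound⟩ := exists_picardTerm_bound (k := k) hρ hq p₀ (|s₀| + 1)
  have hcont : ContinuousOn (Function.uncurry (regularSol k ρ q))
      (Metric.ball p₀ 1 ×ˢ Metric.ball s₀ 1) := by
    refine continuousOn_tsum (f := fun n (z : ℝ × ℝ) => picardTerm k ρ q n z.1 z.2)
      (fun n => (continuous_picardTerm hρ hq n).continuousOn) hb ?_
    rintro n ⟨p, s⟩ ⟨hp, hs⟩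
    rw [Metric.mem_ball, Real.dist_eq] at hp hs
    refine hbound n p s hp.le ?_
    have := abs_sub_abs_le_abs_sub s s₀
    linarith
  exact hcont.continuousAt
    (prod_mem_nhds (Metric.ball_mem_nhds p₀ one_pos) (Metric.ball_mem_nhds s₀ one_pos))

theorem continuous_regularSol_right (hρ : Continuous ρ) (hq : Continuous (Function.uncurry q))
    (p : ℝ) : Continuous (regularSol k ρ q p) :=
  (continuous_regularSol hρ hq).comp (by fun_prop : Continuous fun s : ℝ => (p, s))

/-- The Volterra integral equation solved by the Picard series. -/
theorem regularSol_eq (hρ : Continuous ρ) (hq : Continuous (Function.uncurry q)) (p s : ℝ) :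
    regularSol k ρ q p s = 1 + s * radialAvg 0
      (fun σ => ρ σ * radialAvg k (fun τ => q p τ * regularSol k ρ q p τ) σ) s := by
  obtain ⟨b, hb, hbound⟩ := exists_picardTerm_bound (k := k) hρ hq p |s|
  obtain ⟨A, hA⟩ := (isCompact_Icc (a := -|s|) (b := |s|)).exists_bound_of_continuousOn
    hρ.continuousOn
  have hqc : Continuous (q p) := hq.comp (by fun_prop : Continuous fun s : ℝ => (p, s))
  obtain ⟨B, hB⟩ := (isCompact_Icc (a := -|s|) (b := |s|)).exists_bound_of_continuousOn
    hqc.continuousOn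
  have hc : ∀ n, Continuous (picardTerm k ρ q n p) := fun n =>
    (continuous_picardTerm hρ hq n).comp (by fun_prop : Continuous fun s : ℝ => (p, s))
  have hbd : ∀ n σ, |σ| ≤ |s| → |picardTerm k ρ q n p σ| ≤ b n := fun n σ hσ =>
    hbound n p σ (by simp) hσ
  have hA' : ∀ σ, |σ| ≤ |s| → |ρ σ| ≤ |A| := fun σ hσ =>
    (hA σ (abs_le.mp hσ)).trans (le_abs_self _)
  have hB' : ∀ σ, |σ| ≤ |s| → |q p σ| ≤ |B| := fun σ hσ =>
    (hB σ (abs_le.mp hσ)).trans (le_abs_self _)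
  have hsum : ∀ σ, |σ| ≤ |s| →
      HasSum (fun n => picardTerm k ρ q n p σ) (regularSol k ρ q p σ) := fun σ hσ =>
    (Summable.of_norm_bounded hb fun n => hbd n σ hσ).hasSum
  have hqterm : ∀ n σ, |σ| ≤ |s| → |q p σ * picardTerm k ρ q n p σ| ≤ |B| * b n := by
    intro n σ hσ
    rw [abs_mul]
    exact mul_le_mul (hB' σ hσ) (hbd n σ hσ) (abs_nonneg _) (abs_nonneg _)
  have hinner : ∀ σ, |σ| ≤ |s| →
      HasSum (fun n => radialAvg k (fun τ => q p τ * picardTerm k ρ q n p τ) σ)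
        (radialAvg k (fun τ => q p τ * regularSol k ρ q p τ) σ) := fun σ hσ =>
    hasSum_radialAvg k (fun n => hqc.mul (hc n)) (hb.mul_left |B|)
      (fun n x hx => hqterm n _ ((abs_mul_le_of_mem_Icc hx).trans hσ))
      (fun x hx => (hsum _ ((abs_mul_le_of_mem_Icc hx).trans hσ)).mul_left _)
  have hinner_le : ∀ n σ, |σ| ≤ |s| →
      |radialAvg k (fun τ => q p τ * picardTerm k ρ q n p τ) σ| ≤ |B| * b n := by
    intro n σ hσ
    have h := abs_radialAvg_le k 0 (hqc.mul (hc n)) (s := σ) (C := |B| * b n) (fun x hx => by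
      rw [pow_zero, mul_one]
      exact hqterm n _ ((abs_mul_le_of_mem_Icc hx).trans hσ))
    refine h.trans (div_le_self ((abs_nonneg _).trans (hqterm n σ hσ)) ?_)
    push_cast
    linarith [(Nat.cast_nonneg k : (0 : ℝ) ≤ k)]
  have houter := hasSum_radialAvg 0 (s := s) (b := fun n => |A| * (|B| * b n))
    (F := fun n σ => ρ σ * radialAvg k (fun τ => q p τ * picardTerm k ρ q n p τ) σ)
    (f := fun σ => ρ σ * radialAvg k (fun τ => q p τ * regularSol k ρ q p τ) σ)
    (fun n => hρ.mul (continuous_radialAvg k (hqc.mul (hc n))))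
    ((hb.mul_left |B|).mul_left |A|)
    (fun n x hx => by
      have hx' := abs_mul_le_of_mem_Icc (s := s) hx
      rw [abs_mul]
      exact mul_le_mul (hA' _ hx') (hinner_le n _ hx') (abs_nonneg _) (abs_nonneg _))
    (fun x hx => (hinner _ (abs_mul_le_of_mem_Icc hx)).mul_left _)
  have h2 : HasSum (fun n => picardTerm k ρ q (n + 1) p s) (s * radialAvg 0
      (fun σ => ρ σ * radialAvg k (fun τ => q p τ * regularSol k ρ q p τ) σ) s) :=
    houter.mul_left s
  have h3 := ((hasSum_nat_add_iff' 1).mpr (hsum s le_rfl)).unique h2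
  simp only [Finset.range_one, Finset.sum_singleton, picardTerm] at h3
  linarith

theorem regularSol_zero (hρ : Continuous ρ) (hq : Continuous (Function.uncurry q)) (p : ℝ) :
    regularSol k ρ q p 0 = 1 := by
  rw [regularSol_eq hρ hq]
  simp

theorem hasDerivAt_regularSol (hρ : Continuous ρ) (hq : Continuous (Function.uncurry q))
    (p s : ℝ) : HasDerivAt (regularSol k ρ q p)
      (ρ s * radialAvg k (fun τ => q p τ * regularSol k ρ q p τ) s) s := by
  have hqc : Continuous (q p) := hq.comp (by fun_prop : Continuous fun s : ℝ => (p, s))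
  have h := (hasDerivAt_pow_mul_radialAvg 0 (hρ.mul (continuous_radialAvg k
    (hqc.mul (continuous_regularSol_right (k := k) hρ hq p)))) s).const_add 1
  have he : regularSol k ρ q p = fun s => 1 + s ^ (0 + 1) * radialAvg 0
      (fun σ => ρ σ * radialAvg k (fun τ => q p τ * regularSol k ρ q p τ) σ) s :=
    funext fun s => by rw [zero_add, pow_one]; exact regularSol_eq hρ hq p s
  rw [pow_zero, one_mul] at h
  exact h.congr_of_eventuallyEq (Eventually.of_forall (congrFun he))

theorem deriv_regularSol (hρ : Continuous ρ) (hq : Continuous (Function.uncurry q)) (p s : ℝ) :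
    deriv (regularSol k ρ q p) s =
      ρ s * radialAvg k (fun τ => q p τ * regularSol k ρ q p τ) s :=
  (hasDerivAt_regularSol hρ hq p s).deriv

theorem continuous_deriv_regularSol (hρ : Continuous ρ) (hq : Continuous (Function.uncurry q)) :
    Continuous (Function.uncurry fun p s => deriv (regularSol k ρ q p) s) := by
  have h : (Function.uncurry fun p s => deriv (regularSol k ρ q p) s) = Function.uncurry fun p s =>
      ρ s * radialAvg k (fun τ => q p τ * regularSol k ρ q p τ) s := by
    ext ⟨p, s⟩
    exact deriv_regularSol hρ hq p s
  rw [h]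
  exact (hρ.comp continuous_snd).mul (continuous_radialAvg_uncurry k
    (f := fun p τ => q p τ * regularSol k ρ q p τ) (hq.mul (continuous_regularSol hρ hq)))

/-- Smoothness at the singular point, by bootstrapping: the averaging operator preserves the
class `Cⁿ`, so `w ∈ Cⁿ` makes `w' = ρ · radialAvg k (q w)` of class `Cⁿ`. -/
theorem contDiff_regularSol (hρ : ContDiff ℝ ((⊤ : ℕ∞) : WithTop ℕ∞) ρ)
    (hq : Continuous (Function.uncurry q)) {p : ℝ}
    (hqs : ContDiff ℝ ((⊤ : ℕ∞) : WithTop ℕ∞) (q p)) :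
    ContDiff ℝ ((⊤ : ℕ∞) : WithTop ℕ∞) (regularSol k ρ q p) := by
  rw [contDiff_infty]
  intro n
  induction n with
  | zero => exact contDiff_zero.2 (continuous_regularSol_right hρ.continuous hq p)
  | succ n ih =>
    have h : ContDiff ℝ ((n : WithTop ℕ∞) + 1) (regularSol k ρ q p) := by
      rw [contDiff_succ_iff_deriv]
      refine ⟨fun s => (hasDerivAt_regularSol hρ.continuous hq p s).differentiableAt,
        by simp, ?_⟩
      rw [show deriv (regularSol k ρ q p) = _ from
        funext fun s => deriv_regularSol hρ.continuous hq p s]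
      exact (contDiff_infty.1 hρ n).mul
        (contDiff_radialAvg n k ((contDiff_infty.1 hqs n).mul ih))
    exact_mod_cast h

theorem one_le_regularSol (hρ : Continuous ρ) (hq : Continuous (Function.uncurry q)) {p S : ℝ}
    (hρ0 : ∀ s ∈ Icc 0 S, 0 ≤ ρ s) (hq0 : ∀ s ∈ Icc 0 S, 0 ≤ q p s) :
    ∀ s ∈ Icc 0 S, 1 ≤ regularSol k ρ q p s := by
  have hmul : ∀ s ∈ Icc 0 S, ∀ x ∈ Icc (0 : ℝ) 1, s * x ∈ Icc 0 S := fun s hs x hx =>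
    ⟨mul_nonneg hs.1 hx.1, (mul_le_of_le_one_right hs.1 hx.2).trans hs.2⟩
  have hpos : ∀ n, ∀ s ∈ Icc 0 S, 0 ≤ picardTerm k ρ q n p s := by
    intro n
    induction n with
    | zero => intro s _; exact zero_le_one
    | succ n ih =>
      intro s hs
      refine mul_nonneg hs.1 (radialAvg_nonneg 0 fun x hx => ?_)
      refine mul_nonneg (hρ0 _ (hmul s hs x hx)) (radialAvg_nonneg k fun y hy => ?_)
      have h := hmul _ (hmul s hs x hx) y hy
      exact mul_nonneg (hq0 _ h) (ih _ h)
  intro s hs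
  obtain ⟨b, hb, hbound⟩ := exists_picardTerm_bound (k := k) hρ hq p |s|
  have hsum : Summable fun n => picardTerm k ρ q n p s :=
    Summable.of_norm_bounded hb fun n => hbound n p s (by simp) le_rfl
  exact hsum.le_tsum 0 fun n _ => hpos n s hs

/-- The flux `s^(k+1) P w'` of the regular solution, where `P = 1 / ρ`. -/
theorem hasDerivAt_flux_regularSol (hρ : Continuous ρ) (hq : Continuous (Function.uncurry q))
    {P : ℝ → ℝ} {p s : ℝ} (hP : ∀ᶠ σ in 𝓝 s, ρ σ * P σ = 1) :
    HasDerivAt (fun s => s ^ (k + 1) * P s * deriv (regularSol k ρ q p) s)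
      (s ^ k * (q p s * regularSol k ρ q p s)) s := by
  have hqc : Continuous (q p) := hq.comp (by fun_prop : Continuous fun s : ℝ => (p, s))
  refine (hasDerivAt_pow_mul_radialAvg k
    (hqc.mul (continuous_regularSol_right (k := k) hρ hq p)) s).congr_of_eventuallyEq ?_
  filter_upwards [hP] with σ hσ
  rw [deriv_regularSol hρ hq]
  linear_combination (σ ^ (k + 1) *
    radialAvg k (fun τ => q p τ * regularSol k ρ q p τ) σ) * hσ

/-- A regular solution stays positive as long as the coefficients are small in an integrated
sense: if `η` dominates the coefficients and has primitive `H` with `H(S) ≤ 1/4`, then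
`N = max |w|` satisfies `N ≤ 1 + N/4`, whence `|w - 1| ≤ 1/3`. -/
theorem regularSol_pos_of_small (hρ : Continuous ρ) (hq : Continuous (Function.uncurry q))
    {p S B : ℝ} (hS : 0 ≤ S) (hB : ∀ s ∈ Icc 0 S, |q p s| ≤ B) {H η : ℝ → ℝ}
    (hH : ∀ s ∈ Icc 0 S, HasDerivAt H (η s) s) (hH0 : H 0 = 0) (hHS : H S ≤ 1 / 4)
    (hη : ∀ s ∈ Icc 0 S, |ρ s| * (B / (k + 1)) ≤ η s) :
    ∀ s ∈ Icc 0 S, 0 < regularSol k ρ q p s := by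
  have hqc : Continuous (q p) := hq.comp (by fun_prop : Continuous fun s : ℝ => (p, s))
  set w := regularSol k ρ q p with hw
  have hwc : Continuous w := continuous_regularSol_right hρ hq p
  have hB0 : 0 ≤ B := (abs_nonneg _).trans (hB 0 ⟨le_rfl, hS⟩)
  have hmul : ∀ s ∈ Icc 0 S, ∀ x ∈ Icc (0 : ℝ) 1, s * x ∈ Icc 0 S := fun s hs x hx =>
    ⟨mul_nonneg hs.1 hx.1, (mul_le_of_le_one_right hs.1 hx.2).trans hs.2⟩
  obtain ⟨s₀, hs₀, hmax⟩ := isCompact_Icc.exists_isMaxOn (nonempty_Icc.2 hS)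
    hwc.abs.continuousOn
  set N := |w s₀| with hN
  have hN' : ∀ s ∈ Icc 0 S, |w s| ≤ N := fun s hs => hmax hs
  have hη0 : ∀ s ∈ Icc 0 S, 0 ≤ η s := fun s hs =>
    (by positivity : (0 : ℝ) ≤ |ρ s| * (B / (k + 1))).trans (hη s hs)
  have hderiv : ∀ s ∈ Icc 0 S, |deriv w s| ≤ N * η s := by
    intro s hs
    rw [hw, deriv_regularSol hρ hq, abs_mul]
    have h := abs_radialAvg_le k 0 (hqc.mul hwc) (s := s) (C := B * N) (fun x hx => by
      rw [pow_zero, mul_one, Pi.mul_apply, abs_mul]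
      exact mul_le_mul (hB _ (hmul s hs x hx)) (hN' _ (hmul s hs x hx)) (abs_nonneg _) hB0)
    calc |ρ s| * |radialAvg k (fun τ => q p τ * regularSol k ρ q p τ) s|
        ≤ |ρ s| * (B * N / (((0 : ℕ) : ℝ) + k + 1)) :=
          mul_le_mul_of_nonneg_left h (abs_nonneg _)
      _ = N * (|ρ s| * (B / (k + 1))) := by push_cast; rw [zero_add]; ring
      _ ≤ N * η s := mul_le_mul_of_nonneg_left (hη s hs) (abs_nonneg _)
  have hHmono : MonotoneOn H (Icc 0 S) := by
    refine monotoneOn_of_hasDerivWithinAt_nonneg (f' := η) (convex_Icc 0 S)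
      (fun s hs => (hH s hs).continuousAt.continuousWithinAt) ?_ ?_
    · exact fun s hs => (hH s (interior_subset hs)).hasDerivWithinAt
    · exact fun s hs => hη0 s (interior_subset hs)
  have hdist : ∀ s ∈ Icc 0 S, |w s - 1| ≤ N * (1 / 4) := by
    intro s hs
    have hwd : ∀ s, HasDerivAt w (deriv w s) s := fun s =>
      (hasDerivAt_regularSol hρ hq p s).differentiableAt.hasDerivAt
    have hup : MonotoneOn (fun s => N * H s - w s) (Icc 0 S) := by
      refine monotoneOn_of_hasDerivWithinAt_nonneg (f' := fun s => N * η s - deriv w s)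
        (convex_Icc 0 S) (fun s hs => ?_) (fun s hs => ?_) (fun s hs => ?_)
      · exact (((hH s hs).const_mul N).sub (hwd s)).continuousAt.continuousWithinAt
      · exact (((hH s (interior_subset hs)).const_mul N).sub (hwd s)).hasDerivWithinAt
      · exact sub_nonneg.2 ((le_abs_self _).trans (hderiv s (interior_subset hs)))
    have hlow : MonotoneOn (fun s => N * H s + w s) (Icc 0 S) := by
      refine monotoneOn_of_hasDerivWithinAt_nonneg (f' := fun s => N * η s + deriv w s)
        (convex_Icc 0 S) (fun s hs => ?_) (fun s hs => ?_) (fun s hs => ?_)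
      · exact (((hH s hs).const_mul N).add (hwd s)).continuousAt.continuousWithinAt
      · exact (((hH s (interior_subset hs)).const_mul N).add (hwd s)).hasDerivWithinAt
      · have := (neg_abs_le (deriv w s)); have := hderiv s (interior_subset hs); linarith
    have h1 := hup ⟨le_rfl, hS⟩ hs hs.1
    have h2 := hlow ⟨le_rfl, hS⟩ hs hs.1
    have h0 : w 0 = 1 := regularSol_zero hρ hq p
    simp only [hH0, h0, mul_zero] at h1 h2
    have h3 : N * H s ≤ N * (1 / 4) :=
      mul_le_mul_of_nonneg_left ((hHmono hs ⟨hS, le_rfl⟩ hs.2).trans hHS) (abs_nonneg _)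
    rw [abs_le]
    constructor <;> linarith
  have hNle : N ≤ 4 / 3 := by
    have h1 := hdist s₀ hs₀
    have h2 : N ≤ |w s₀ - 1| + 1 := by
      have := abs_add_le (w s₀ - 1) 1
      simpa using this
    linarith
  intro s hs
  have := (abs_le.mp (hdist s hs)).1
  linarith

end

/-! ### Positive smooth reciprocals, uniqueness, and zeros in families -/

/-- A smooth function that is positive on `[a, b]` has there the reciprocal of a positive function
smooth on all of `ℝ`. -/
theorem exists_contDiff_mul_eq_one {P : ℝ → ℝ} (hP : ContDiff ℝ ((⊤ : ℕ∞) : WithTop ℕ∞) P)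
    {a b : ℝ} (hpos : ∀ s ∈ Icc a b, 0 < P s) :
    ∃ ρ : ℝ → ℝ, ContDiff ℝ ((⊤ : ℕ∞) : WithTop ℕ∞) ρ ∧ (∀ s, 0 < ρ s) ∧
      ∀ s ∈ Icc a b, ρ s * P s = 1 := by
  have hclosed : IsClosed {s | P s ≤ 0} := isClosed_le hP.continuous continuous_const
  have hdisj : Disjoint {s | P s ≤ 0} (Icc a b) :=
    Set.disjoint_left.2 fun s hs hs' => absurd (hpos s hs') (not_lt.2 hs)
  obtain ⟨χ, hχ, hrange, h0, h1⟩ := exists_contMDiff_zero_iff_one_iff_of_isClosed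
    (n := (⊤ : ℕ∞)) (modelWithCornersSelf ℝ ℝ) hclosed isClosed_Icc hdisj
  rw [contMDiff_iff_contDiff] at hχ
  have hχ01 : ∀ s, 0 ≤ χ s ∧ χ s ≤ 1 := fun s => hrange ⟨s, rfl⟩
  have hpos' : ∀ s, 0 < χ s * P s + (1 - χ s) := by
    intro s
    rcases le_or_gt (P s) 0 with h | h
    · rw [(h0 s).1 h]; norm_num
    · rcases eq_or_lt_of_le (hχ01 s).1 with h' | h'
      · rw [← h']; norm_num
      · have := mul_pos h' h
        linarith [(hχ01 s).2]
  refine ⟨fun s => (χ s * P s + (1 - χ s))⁻¹, ?_, fun s => inv_pos.2 (hpos' s), fun s hs => ?_⟩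
  · exact ((hχ.mul hP).add (contDiff_const.sub hχ)).inv fun s => (hpos' s).ne'
  · have h := (h1 s).1 hs
    have h2 := hpos s hs
    simp only [h, one_mul, sub_self, add_zero]
    exact inv_mul_cancel₀ h2.ne'

/-- Uniqueness for a linear system `f' = α g`, `g' = β f`. -/
theorem eq_zero_of_linear_system {f g α β : ℝ → ℝ} {a b t₀ : ℝ} (ht₀ : t₀ ∈ Ioo a b)
    (hα : ContinuousOn α (Ioo a b)) (hβ : ContinuousOn β (Ioo a b))
    (hf : ∀ t ∈ Ioo a b, HasDerivAt f (α t * g t) t)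
    (hg : ∀ t ∈ Ioo a b, HasDerivAt g (β t * f t) t) (hf0 : f t₀ = 0) (hg0 : g t₀ = 0) :
    ∀ t ∈ Ioo a b, f t = 0 := by
  intro t ht
  obtain ⟨a', ha, ha'⟩ := exists_between (lt_min ht.1 ht₀.1)
  obtain ⟨b', hb', hb⟩ := exists_between (max_lt ht.2 ht₀.2)
  have hsub : Icc a' b' ⊆ Ioo a b := fun x hx => ⟨ha.trans_le hx.1, hx.2.trans_lt hb⟩
  obtain ⟨A, hA⟩ := isCompact_Icc.exists_bound_of_continuousOn (hα.mono hsub)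
  obtain ⟨B, hB⟩ := isCompact_Icc.exists_bound_of_continuousOn (hβ.mono hsub)
  have hlip : ∀ s ∈ Ioo a' b', LipschitzOnWith (max A B).toNNReal
      (fun z : ℝ × ℝ => (α s * z.2, β s * z.1)) univ := by
    intro s hs
    rw [lipschitzOnWith_univ]
    refine LipschitzWith.of_dist_le_mul fun z z' => ?_
    have hs' := Ioo_subset_Icc_self hs
    have h1 : (0 : ℝ) ≤ max A B := ((norm_nonneg _).trans (hA s hs')).trans (le_max_left _ _)
    rw [Real.coe_toNNReal _ h1, dist_eq_norm, dist_eq_norm, Prod.norm_def]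
    refine max_le ?_ ?_
    · simp only [Prod.fst_sub, ← mul_sub, norm_mul]
      exact mul_le_mul ((hA s hs').trans (le_max_left _ _)) (norm_snd_le (z - z'))
        (norm_nonneg _) h1
    · simp only [Prod.snd_sub, ← mul_sub, norm_mul]
      exact mul_le_mul ((hB s hs').trans (le_max_right _ _)) (norm_fst_le (z - z'))
        (norm_nonneg _) h1
  have ht' : t ∈ Ioo a' b' :=
    ⟨ha'.trans_le (min_le_left _ _), (le_max_left _ _).trans_lt hb'⟩
  have ht₀' : t₀ ∈ Ioo a' b' :=
    ⟨ha'.trans_le (min_le_right _ _), (le_max_right _ _).trans_lt hb'⟩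
  have key := ODE_solution_unique_of_mem_Ioo (f := fun s => (f s, g s)) (g := fun _ => (0, 0))
    (v := fun s z => (α s * z.2, β s * z.1)) (s := fun _ => univ) hlip ht₀'
    (fun s hs => by
      have hs' := hsub (Ioo_subset_Icc_self hs)
      exact ⟨(hf s hs').prodMk (hg s hs'), mem_univ _⟩)
    (fun s _ => ⟨by simpa [← Prod.zero_eq_mk] using hasDerivAt_const s (0 : ℝ × ℝ), mem_univ _⟩)
    (by simp [hf0, hg0])
  exact congrArg Prod.fst (key ht')

/-- A family of functions on `[0, 1]` that is positive for the parameter `0` and not for `b` has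
a member that is nonnegative and touches zero. -/
theorem exists_touching_zero {F : ℝ → ℝ → ℝ} {b : ℝ} (hb : 0 ≤ b)
    (hF : ContinuousOn (Function.uncurry F) (Icc 0 b ×ˢ Icc 0 1))
    (h0 : ∀ x ∈ Icc (0 : ℝ) 1, 0 < F 0 x) (h1 : ∃ x ∈ Icc (0 : ℝ) 1, F b x ≤ 0) :
    ∃ p ∈ Icc 0 b, ∃ x ∈ Icc (0 : ℝ) 1, F p x = 0 ∧ ∀ y ∈ Icc (0 : ℝ) 1, 0 ≤ F p y := by
  let G : ℝ → ℝ → ℝ := fun p x => F (projIcc 0 b hb p) (projIcc 0 1 zero_le_one x)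
  have hG : Continuous (Function.uncurry G) := by
    refine hF.comp_continuous
      (f := fun z : ℝ × ℝ => ((projIcc 0 b hb z.1 : ℝ), (projIcc (0 : ℝ) 1 zero_le_one z.2 : ℝ)))
      ?_ fun z => ⟨Subtype.prop _, Subtype.prop _⟩
    exact ((continuous_subtype_val.comp continuous_projIcc).comp continuous_fst).prodMk
      ((continuous_subtype_val.comp continuous_projIcc).comp continuous_snd)
  have hGF : ∀ p ∈ Icc 0 b, ∀ x ∈ Icc (0 : ℝ) 1, G p x = F p x := by
    intro p hp x hx
    simp only [G, projIcc_of_mem hb hp, projIcc_of_mem zero_le_one hx]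
  have hm : Continuous fun p => sInf (G p '' Icc 0 1) := isCompact_Icc.continuous_sInf hG
  have hattain : ∀ p, ∃ x ∈ Icc (0 : ℝ) 1, sInf (G p '' Icc 0 1) = G p x ∧
      ∀ y ∈ Icc (0 : ℝ) 1, G p x ≤ G p y := fun p =>
    isCompact_Icc.exists_sInf_image_eq_and_le (nonempty_Icc.2 zero_le_one)
      (hG.comp (by fun_prop : Continuous fun x : ℝ => (p, x))).continuousOn
  have hm0 : 0 ≤ sInf (G 0 '' Icc 0 1) := by
    obtain ⟨x, hx, hxe, -⟩ := hattain 0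
    rw [hxe, hGF 0 ⟨le_rfl, hb⟩ x hx]
    exact (h0 x hx).le
  have hm1 : sInf (G b '' Icc 0 1) ≤ 0 := by
    obtain ⟨x, hx, hxe, hmin⟩ := hattain b
    obtain ⟨y, hy, hy0⟩ := h1
    rw [hxe]
    exact (hmin y hy).trans (by rwa [hGF b ⟨hb, le_rfl⟩ y hy])
  obtain ⟨p, hp, hpe⟩ := intermediate_value_Icc' hb hm.continuousOn ⟨hm1, hm0⟩
  obtain ⟨x, hx, hxe, hmin⟩ := hattain p
  have hx0 : G p x = 0 := hxe.symm.trans hpe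
  refine ⟨p, hp, x, hx, by rwa [← hGF p hp x hx], fun y hy => ?_⟩
  rw [← hGF p hp y hy, ← hx0]
  exact hmin y hy

/-! ### Existence of the angular ground state -/

section

variable {k : ℕ} {ρ : ℝ → ℝ} {q : ℝ → ℝ → ℝ}

theorem deriv_regularSol_nonneg (hρ : Continuous ρ) (hq : Continuous (Function.uncurry q))
    {p s : ℝ} (hs : 0 ≤ s) (hρs : 0 ≤ ρ s)
    (h : ∀ τ ∈ Icc 0 s, 0 ≤ q p τ * regularSol k ρ q p τ) :
    0 ≤ deriv (regularSol k ρ q p) s := by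
  rw [deriv_regularSol hρ hq]
  refine mul_nonneg hρs (radialAvg_nonneg k fun x hx => h _ ?_)
  exact ⟨mul_nonneg hs hx.1, mul_le_of_le_one_right hs hx.2⟩

theorem deriv_regularSol_nonpos (hρ : Continuous ρ) (hq : Continuous (Function.uncurry q))
    {p s : ℝ} (hs : 0 ≤ s) (hρs : 0 ≤ ρ s)
    (h : ∀ τ ∈ Icc 0 s, q p τ * regularSol k ρ q p τ ≤ 0) :
    deriv (regularSol k ρ q p) s ≤ 0 := by
  rw [deriv_regularSol hρ hq]
  refine mul_nonpos_of_nonneg_of_nonpos hρs ?_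
  have := radialAvg_nonneg k (f := fun τ => -(q p τ * regularSol k ρ q p τ)) (s := s)
    fun x hx => neg_nonneg.2 (h _ ⟨mul_nonneg hs hx.1, mul_le_of_le_one_right hs hx.2⟩)
  simp only [radialAvg, mul_neg, intervalIntegral.integral_neg] at this
  simp only [radialAvg]
  linarith

end

/-- The smallness of `K log n / n` that makes the two shooting solutions positive up to the point
where they are matched. -/
theorem exists_log_bound (K : ℝ) (hK : 0 ≤ K) : ∃ ℓ₀ : ℕ, ∀ ℓ : ℕ, ℓ₀ ≤ ℓ →
    K / (2 * (ℓ + 1)) ≤ 1 / 4 ∧ K / (2 * (ℓ + 1)) * Real.log (2 * (ℓ + 1)) ≤ 1 / 4 := by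
  have h := Real.isLittleO_log_id_atTop.def (c := 1 / (4 * (K + 1))) (by positivity)
  obtain ⟨T, hT⟩ := eventually_atTop.1 h
  obtain ⟨N, hN⟩ := exists_nat_ge (max T (2 * K))
  refine ⟨N, fun ℓ hℓ => ?_⟩
  have hℓ' : (N : ℝ) ≤ ℓ := by exact_mod_cast hℓ
  have h1 : T ≤ ℓ := (le_max_left _ _).trans (hN.trans hℓ')
  have h2 : 2 * K ≤ ℓ := (le_max_right _ _).trans (hN.trans hℓ')
  have h0 : (0 : ℝ) ≤ ℓ := Nat.cast_nonneg ℓ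
  have hn : (0 : ℝ) < 2 * (ℓ + 1) := by positivity
  constructor
  · rw [div_le_iff₀ hn]; linarith
  · have h3 := hT (2 * (ℓ + 1)) (by linarith)
    rw [id, Real.norm_of_nonneg hn.le] at h3
    have h4 : Real.log (2 * (ℓ + 1)) ≤ 1 / (4 * (K + 1)) * (2 * (ℓ + 1)) :=
      (le_abs_self _).trans h3
    calc K / (2 * (ℓ + 1)) * Real.log (2 * (ℓ + 1))
        ≤ K / (2 * (ℓ + 1)) * (1 / (4 * (K + 1)) * (2 * (ℓ + 1))) := by gcongr
      _ = K / (K + 1) * (1 / 4) := by field_simp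
      _ ≤ 1 * (1 / 4) := by
        gcongr
        rw [div_le_one (by linarith)]
        linarith
      _ = 1 / 4 := one_mul _

/-- The lowest angular eigenfunction, in the form `sin^ℓ θ · y(cos² θ)` with `y` smooth and
positive. The solutions regular at `x = 0` and at `x = 1` are compared at
`x = 1 / (2 (ℓ + 1))`, the width of the ground state, up to which both remain positive; their
Wronskian there changes sign as `δ` runs through `[-|κ|, |κ|]`. -/
theorem exists_angular_ground_state (K : ℝ) (hK : 0 ≤ K) : ∃ ℓ₀ : ℕ, ∀ ℓ : ℕ, ℓ₀ ≤ ℓ →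
    ∀ κ : ℝ, |κ| ≤ K → ∃ (δ : ℝ) (y : ℝ → ℝ), |δ| ≤ |κ| ∧
      ContDiff ℝ ((⊤ : ℕ∞) : WithTop ℕ∞) y ∧ (∀ x ∈ Icc (0 : ℝ) 1, 0 < y x) ∧
      ∀ x ∈ Ioo (0 : ℝ) 1, HasDerivAt (fun x => x * (1 - x) ^ (ℓ + 1) * deriv y x)
        ((1 - x) ^ ℓ * ((κ * x - δ) / 4 * y x)) x := by
  obtain ⟨ℓ₀, hℓ₀⟩ := exists_log_bound K hK
  refine ⟨ℓ₀, fun ℓ hℓ κ hκ => ?_⟩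
  obtain ⟨hb0, hb1⟩ := hℓ₀ ℓ hℓ
  have hnpos : (0 : ℝ) < ℓ + 1 := by positivity
  have hn1 : (1 : ℝ) ≤ ℓ + 1 := by linarith [(Nat.cast_nonneg ℓ : (0 : ℝ) ≤ ℓ)]
  set m : ℝ := 1 / (2 * (ℓ + 1)) with hm
  have hm0 : 0 < m := by positivity
  have hm1 : m ≤ 1 / 2 := by
    rw [hm, div_le_div_iff₀ (by positivity) (by norm_num)]; linarith
  have hmn : (ℓ + 1 : ℝ) * m = 1 / 2 := by rw [hm]; field_simp
  -- the coefficients at the end points `x = 0` and `x = 1`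
  obtain ⟨ρ₀, hρ₀, hρ₀pos, hρ₀P⟩ := exists_contDiff_mul_eq_one (P := fun x => (1 - x) ^ (ℓ + 1))
    (by fun_prop) (a := 0) (b := 3 / 4) (fun x hx => pow_pos (by linarith [hx.2]) _)
  obtain ⟨ρ₁, hρ₁, hρ₁pos, hρ₁P⟩ := exists_contDiff_mul_eq_one (P := fun s => 1 - s)
    (by fun_prop) (a := 0) (b := 1 - m / 2) (fun x hx => by linarith [hx.2])
  let q₀ : ℝ → ℝ → ℝ := fun δ x => (1 - x) ^ ℓ * ((κ * x - δ) / 4)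
  let q₁ : ℝ → ℝ → ℝ := fun δ s => (κ * (1 - s) - δ) / 4
  have hq₀ : Continuous (Function.uncurry q₀) := by
    change Continuous fun z : ℝ × ℝ => (1 - z.2) ^ ℓ * ((κ * z.2 - z.1) / 4)
    fun_prop
  have hq₁ : Continuous (Function.uncurry q₁) := by
    change Continuous fun z : ℝ × ℝ => (κ * (1 - z.2) - z.1) / 4
    fun_prop
  let y₀ := regularSol 0 ρ₀ q₀
  let y₁ := regularSol ℓ ρ₁ q₁
  have habs : ∀ δ, |δ| ≤ |κ| → ∀ x ∈ Icc (0 : ℝ) 1, |(κ * x - δ) / 4| ≤ K / 2 := by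
    intro δ hδ x hx
    have h1 : |κ * x| ≤ |κ| := by
      rw [abs_mul, abs_of_nonneg hx.1]; exact mul_le_of_le_one_right (abs_nonneg _) hx.2
    rw [abs_div, abs_of_pos (by norm_num : (0 : ℝ) < 4), div_le_iff₀ (by norm_num)]
    linarith [abs_sub (κ * x) δ]
  have hy₀pos : ∀ δ, |δ| ≤ |κ| → ∀ x ∈ Icc 0 m, 0 < y₀ δ x := by
    intro δ hδ
    refine regularSol_pos_of_small hρ₀.continuous hq₀ hm0.le (B := K / 2) (fun x hx => ?_)
      (H := fun x => K * x) (η := fun _ => K) (fun x _ => by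
        simpa using (hasDerivAt_id x).const_mul K) (by simp) ?_ (fun x hx => ?_)
    · have hx1 : x ≤ 1 := by linarith [hx.2]
      simp only [q₀]
      rw [abs_mul, abs_of_nonneg (pow_nonneg (by linarith) ℓ)]
      exact (mul_le_of_le_one_left (abs_nonneg _)
        (pow_le_one₀ (by linarith) (by linarith [hx.1]))).trans (habs δ hδ x ⟨hx.1, hx1⟩)
    · rw [hm, mul_one_div]
      exact hb0
    · -- Bernoulli: `(1 - x)^(ℓ+1) ≥ 1 - (ℓ+1) x ≥ 1/2`
      have h1 := one_add_mul_le_pow (a := -x) (by linarith [hx.2]) (ℓ + 1)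
      have h2 : ρ₀ x * (1 - x) ^ (ℓ + 1) = 1 := hρ₀P x ⟨hx.1, by linarith [hx.2]⟩
      have h3 : 1 / 2 ≤ (1 - x) ^ (ℓ + 1) := by
        have h4 : (ℓ + 1 : ℝ) * x ≤ 1 / 2 := by
          rw [← hmn]; exact mul_le_mul_of_nonneg_left hx.2 hnpos.le
        push_cast at h1
        rw [← sub_eq_add_neg] at h1
        linarith
      have h4 : ρ₀ x ≤ 2 := by
        have := mul_le_mul_of_nonneg_left h3 (hρ₀pos x).le
        linarith
      rw [abs_of_pos (hρ₀pos x)]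
      push_cast
      have := mul_le_mul_of_nonneg_right h4 (by linarith : 0 ≤ K / 2)
      simp only [zero_add, div_one]
      linarith
  have hy₁pos : ∀ δ, |δ| ≤ |κ| → ∀ s ∈ Icc 0 (1 - m), 0 < y₁ δ s := by
    intro δ hδ
    refine regularSol_pos_of_small hρ₁.continuous hq₁ (by linarith) (B := K / 2)
      (fun s hs => habs δ hδ (1 - s) ⟨by linarith [hs.2], by linarith [hs.1]⟩)
      (H := fun s => -(K / (2 * (ℓ + 1))) * Real.log (1 - s))
      (η := fun s => K / (2 * (ℓ + 1)) * (1 / (1 - s))) (fun s hs => ?_) (by simp) ?_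
      (fun s hs => ?_)
    · have h1 : HasDerivAt (fun s : ℝ => 1 - s) (-1) s := by
        simpa using (hasDerivAt_id s).const_sub 1
      refine ((h1.log (by linarith [hs.2])).const_mul _).congr_deriv ?_
      ring
    · have h1 : Real.log (1 - (1 - m)) = -Real.log (2 * (ℓ + 1)) := by
        rw [sub_sub_cancel, hm, one_div, Real.log_inv]
      simp only [h1]
      linarith
    · have h1 : 0 < 1 - s := by linarith [hs.2]
      have h2 : ρ₁ s * (1 - s) = 1 := hρ₁P s ⟨hs.1, by linarith [hs.2]⟩
      rw [abs_of_pos (hρ₁pos s), eq_one_div_of_mul_eq_one_left h2]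
      apply le_of_eq
      field_simp
  -- the Wronskian at the matching point
  let A : ℝ → ℝ := fun δ => deriv (y₀ δ) m * y₁ δ (1 - m) + y₀ δ m * deriv (y₁ δ) (1 - m)
  have hA : Continuous A := by
    have e0 : Continuous fun δ : ℝ => (δ, m) := by fun_prop
    have e1 : Continuous fun δ : ℝ => (δ, 1 - m) := by fun_prop
    exact (((continuous_deriv_regularSol hρ₀.continuous hq₀).comp e0).mul
      ((continuous_regularSol hρ₁.continuous hq₁).comp e1)).add
      (((continuous_regularSol hρ₀.continuous hq₀).comp e0).mul
      ((continuous_deriv_regularSol hρ₁.continuous hq₁).comp e1))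
  have hm1' : 0 ≤ 1 - m := by linarith
  have hxκ : ∀ x ∈ Icc (0 : ℝ) 1, |κ * x| ≤ |κ| := fun x hx => by
    rw [abs_mul, abs_of_nonneg hx.1]; exact mul_le_of_le_one_right (abs_nonneg _) hx.2
  have hA_left : 0 ≤ A (-|κ|) := by
    have hδ : |(-|κ|)| ≤ |κ| := by simp
    have hq : ∀ x ∈ Icc (0 : ℝ) 1, 0 ≤ (κ * x - -|κ|) / 4 := fun x hx => by
      linarith [(abs_le.mp (hxκ x hx)).1]
    have h0 := hy₀pos _ hδ
    have h1 := hy₁pos _ hδ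
    refine add_nonneg (mul_nonneg ?_ (h1 _ ⟨hm1', le_rfl⟩).le)
      (mul_nonneg (h0 _ ⟨hm0.le, le_rfl⟩).le ?_)
    · refine deriv_regularSol_nonneg hρ₀.continuous hq₀ hm0.le (hρ₀pos _).le fun τ hτ => ?_
      have : τ ≤ 1 := by linarith [hτ.2]
      exact mul_nonneg (mul_nonneg (pow_nonneg (by linarith) _) (hq τ ⟨hτ.1, this⟩)) (h0 τ hτ).le
    · refine deriv_regularSol_nonneg hρ₁.continuous hq₁ hm1' (hρ₁pos _).le fun τ hτ => ?_
      exact mul_nonneg (hq (1 - τ) ⟨by linarith [hτ.2], by linarith [hτ.1]⟩) (h1 τ hτ).le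
  have hA_right : A |κ| ≤ 0 := by
    have hδ : |(|κ|)| ≤ |κ| := by simp
    have hq : ∀ x ∈ Icc (0 : ℝ) 1, (κ * x - |κ|) / 4 ≤ 0 := fun x hx => by
      linarith [(abs_le.mp (hxκ x hx)).2]
    have h0 := hy₀pos _ hδ
    have h1 := hy₁pos _ hδ
    refine add_nonpos (mul_nonpos_of_nonpos_of_nonneg ?_ (h1 _ ⟨hm1', le_rfl⟩).le)
      (mul_nonpos_of_nonneg_of_nonpos (h0 _ ⟨hm0.le, le_rfl⟩).le ?_)
    · refine deriv_regularSol_nonpos hρ₀.continuous hq₀ hm0.le (hρ₀pos _).le fun τ hτ => ?_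
      have : τ ≤ 1 := by linarith [hτ.2]
      exact mul_nonpos_of_nonpos_of_nonneg (mul_nonpos_of_nonneg_of_nonpos
        (pow_nonneg (by linarith) _) (hq τ ⟨hτ.1, this⟩)) (h0 τ hτ).le
    · refine deriv_regularSol_nonpos hρ₁.continuous hq₁ hm1' (hρ₁pos _).le fun τ hτ => ?_
      exact mul_nonpos_of_nonpos_of_nonneg (hq (1 - τ) ⟨by linarith [hτ.2], by linarith [hτ.1]⟩)
        (h1 τ hτ).le
  obtain ⟨δ, hδI, hAδ⟩ := intermediate_value_Icc' (neg_le_self (abs_nonneg κ)) hA.continuousOn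
    ⟨hA_right, hA_left⟩
  have hδ : |δ| ≤ |κ| := abs_le.2 hδI
  have hc₀ := hy₁pos δ hδ (1 - m) ⟨hm1', le_rfl⟩
  have hc₁ := hy₀pos δ hδ m ⟨hm0.le, le_rfl⟩
  set c₀ := y₁ δ (1 - m) with hc₀_def
  set c₁ := y₀ δ m with hc₁_def
  have hy₀s : ContDiff ℝ ((⊤ : ℕ∞) : WithTop ℕ∞) (y₀ δ) :=
    contDiff_regularSol hρ₀ hq₀ (by simp only [q₀]; fun_prop)
  have hy₁s : ContDiff ℝ ((⊤ : ℕ∞) : WithTop ℕ∞) (y₁ δ) :=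
    contDiff_regularSol hρ₁ hq₁ (by simp only [q₁]; fun_prop)
  have hd₀ : ∀ x, HasDerivAt (y₀ δ) (deriv (y₀ δ) x) x := fun x =>
    (hy₀s.differentiable (by simp)).differentiableAt.hasDerivAt
  have hd₁ : ∀ x, HasDerivAt (fun x => y₁ δ (1 - x)) (-deriv (y₁ δ) (1 - x)) x := fun x => by
    have h1 : HasDerivAt (y₁ δ) (deriv (y₁ δ) (1 - x)) (1 - x) :=
      (hy₁s.differentiable (by simp)).differentiableAt.hasDerivAt
    exact (h1.comp_const_sub 1 x)
  -- the equation in divergence form, for each of the two solutions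
  have hflux₀ : ∀ x ∈ Ioo (0 : ℝ) (3 / 4), HasDerivAt
      (fun x => x * (1 - x) ^ (ℓ + 1) * deriv (y₀ δ) x)
      ((1 - x) ^ ℓ * ((κ * x - δ) / 4 * y₀ δ x)) x := by
    intro x hx
    have h := hasDerivAt_flux_regularSol (k := 0) hρ₀.continuous hq₀ (p := δ) (s := x)
      (P := fun x => (1 - x) ^ (ℓ + 1)) (by
        filter_upwards [isOpen_Ioo.mem_nhds hx] with σ hσ
        exact hρ₀P σ (Ioo_subset_Icc_self hσ))
    simp only [zero_add, pow_one, pow_zero, one_mul] at h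
    refine h.congr_deriv ?_
    simp only [q₀, y₀]
    ring
  have hflux₁ : ∀ x ∈ Ioo (m / 2) 1, HasDerivAt
      (fun x => x * (1 - x) ^ (ℓ + 1) * deriv (y₁ δ) (1 - x))
      (-((1 - x) ^ ℓ * ((κ * x - δ) / 4 * y₁ δ (1 - x)))) x := by
    intro x hx
    have hx' : 1 - x ∈ Ioo (0 : ℝ) (1 - m / 2) := ⟨by linarith [hx.2], by linarith [hx.1]⟩
    have h := (hasDerivAt_flux_regularSol (k := ℓ) hρ₁.continuous hq₁ (p := δ) (s := 1 - x)
      (P := fun s => 1 - s) (by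
        filter_upwards [isOpen_Ioo.mem_nhds hx'] with σ hσ
        exact hρ₁P σ (Ioo_subset_Icc_self hσ))).comp_const_sub 1 x
    simp only [sub_sub_cancel] at h
    have he : (fun x => x * (1 - x) ^ (ℓ + 1) * deriv (y₁ δ) (1 - x)) = fun x =>
        (1 - x) ^ (ℓ + 1) * x * deriv (regularSol ℓ ρ₁ q₁ δ) (1 - x) := by
      ext x; simp only [y₁]; ring
    rw [he]
    refine h.congr_deriv ?_
    simp only [q₁, y₁, sub_sub_cancel]
  -- vanishing Wronskian: the two solutions are proportional
  have hagree : ∀ x ∈ Ioo (m / 2) (3 / 4), c₀ * y₀ δ x = c₁ * y₁ δ (1 - x) := by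
    intro x hx
    have hpos : ∀ t ∈ Ioo (m / 2) (3 / 4), 0 < t * (1 - t) ^ (ℓ + 1) := fun t ht =>
      mul_pos (by linarith [ht.1]) (pow_pos (by linarith [ht.2]) _)
    have h := eq_zero_of_linear_system (a := m / 2) (b := 3 / 4) (t₀ := m)
      (f := fun x => c₀ * y₀ δ x - c₁ * y₁ δ (1 - x))
      (g := fun x => c₀ * (x * (1 - x) ^ (ℓ + 1) * deriv (y₀ δ) x) +
        c₁ * (x * (1 - x) ^ (ℓ + 1) * deriv (y₁ δ) (1 - x)))
      (α := fun x => (x * (1 - x) ^ (ℓ + 1))⁻¹)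
      (β := fun x => (1 - x) ^ ℓ * ((κ * x - δ) / 4)) ⟨by linarith, by linarith⟩
      (ContinuousOn.inv₀ (by fun_prop) fun t ht => (hpos t ht).ne') (by fun_prop)
      (fun t ht => by
        refine (((hd₀ t).const_mul c₀).sub ((hd₁ t).const_mul c₁)).congr_deriv ?_
        have h0 := (hpos t ht).ne'
        generalize t * (1 - t) ^ (ℓ + 1) = X at h0 ⊢
        field_simp
        ring)
      (fun t ht => by
        refine (((hflux₀ t ⟨by linarith [ht.1], ht.2⟩).const_mul c₀).add
          ((hflux₁ t ⟨ht.1, by linarith [ht.2]⟩).const_mul c₁)).congr_deriv ?_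
        ring)
      (by simp only [hc₀_def, hc₁_def]; ring)
      (by
        have : A δ = deriv (y₀ δ) m * c₀ + c₁ * deriv (y₁ δ) (1 - m) := rfl
        rw [this] at hAδ
        linear_combination (m * (1 - m) ^ (ℓ + 1)) * hAδ)
      x hx
    exact sub_eq_zero.1 h
  let Y : ℝ → ℝ := fun x => if x < m then c₀ * y₀ δ x else c₁ * y₁ δ (1 - x)
  have hYl : ∀ x < 3 / 4, Y x = c₀ * y₀ δ x := by
    intro x hx
    simp only [Y]
    split_ifs with h
    · rfl
    · exact (hagree x ⟨by linarith, hx⟩).symm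
  have hYr : ∀ x > m / 2, Y x = c₁ * y₁ δ (1 - x) := by
    intro x hx
    simp only [Y]
    split_ifs with h
    · exact hagree x ⟨hx, by linarith⟩
    · rfl
  have hYl' : ∀ x < 3 / 4, Y =ᶠ[𝓝 x] fun x => c₀ * y₀ δ x := fun x hx => by
    filter_upwards [isOpen_Iio.mem_nhds hx] with z hz using hYl z hz
  have hYr' : ∀ x > m / 2, Y =ᶠ[𝓝 x] fun x => c₁ * y₁ δ (1 - x) := fun x hx => by
    filter_upwards [isOpen_Ioi.mem_nhds hx] with z hz using hYr z hz
  refine ⟨δ, Y, hδ, ?_, ?_, ?_⟩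
  · rw [contDiff_iff_contDiffAt]
    intro x
    rcases lt_or_ge x (3 / 4) with hx | hx
    · exact (contDiff_const.mul hy₀s).contDiffAt.congr_of_eventuallyEq (hYl' x hx)
    · exact (contDiff_const.mul (hy₁s.comp (by fun_prop :
        ContDiff ℝ ((⊤ : ℕ∞) : WithTop ℕ∞) fun x : ℝ => 1 - x))).contDiffAt.congr_of_eventuallyEq
        (hYr' x (by linarith))
  · intro x hx
    rcases lt_or_ge x m with h | h
    · rw [hYl x (by linarith)]
      exact mul_pos hc₀ (hy₀pos δ hδ x ⟨hx.1, h.le⟩)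
    · rw [hYr x (by linarith)]
      exact mul_pos hc₁ (hy₁pos δ hδ _ ⟨by linarith [hx.2], by linarith⟩)
  · intro x hx
    rcases lt_or_ge x (3 / 4) with h | h
    · have h1 := (hflux₀ x ⟨hx.1, h⟩).const_mul c₀
      refine (h1.congr_of_eventuallyEq ?_).congr_deriv (by rw [hYl x h]; ring)
      filter_upwards [isOpen_Iio.mem_nhds h] with z hz
      rw [(hYl' z hz).deriv_eq, ((hd₀ z).const_mul c₀).deriv]
      ring
    · have hx' : m / 2 < x := by linarith
      have h1 := (hflux₁ x ⟨hx', hx.2⟩).const_mul (-c₁)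
      refine (h1.congr_of_eventuallyEq ?_).congr_deriv (by rw [hYr x hx']; ring)
      filter_upwards [isOpen_Ioi.mem_nhds hx'] with z hz
      rw [(hYr' z hz).deriv_eq, ((hd₁ z).const_mul c₁).deriv]
      ring

/-! ### Comparison of angular eigenvalues -/

theorem hasDerivAt_pow_of_ne_zero {f : ℝ → ℝ} {f' x : ℝ} (hf : HasDerivAt f f' x) (hx : f x ≠ 0)
    (n : ℕ) : HasDerivAt (fun t => f t ^ n) (n * f x ^ n * (f' / f x)) x := by
  refine (hf.pow n).congr_deriv ?_
  cases n with
  | zero => simp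
  | succ n =>
    rw [Nat.add_sub_cancel, pow_succ]
    field_simp

/-- `y` is the profile, in the variable `x = cos² θ`, of a positive angular eigenfunction
`sin^ℓ θ · y(cos² θ)` with eigenvalue `ℓ (ℓ + 2) + δ`; the potential is `κ cos² θ`. -/
structure IsAngularProfile (ℓ : ℕ) (κ δ : ℝ) (y : ℝ → ℝ) : Prop where
  contDiff : ContDiff ℝ ((⊤ : ℕ∞) : WithTop ℕ∞) y
  pos : ∀ x ∈ Icc (0 : ℝ) 1, 0 < y x
  ode : ∀ x ∈ Ioo (0 : ℝ) 1, x * (1 - x) * deriv (deriv y) x +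
    (1 - x - (ℓ + 1) * x) * deriv y x = (κ * x - δ) / 4 * y x

/-- The angular function `sin^ℓ θ · y(cos² θ)`. -/
noncomputable def angularMode (ℓ : ℕ) (y : ℝ → ℝ) (θ : ℝ) : ℝ :=
  Real.sin θ ^ ℓ * y (Real.cos θ ^ 2)

theorem hasDerivAt_deriv_of_contDiff {f : ℝ → ℝ} (hf : ContDiff ℝ ((⊤ : ℕ∞) : WithTop ℕ∞) f)
    (x : ℝ) : HasDerivAt f (deriv f x) x :=
  (hf.differentiable (by simp)).differentiableAt.hasDerivAt

theorem contDiff_deriv_of_contDiff {f : ℝ → ℝ} (hf : ContDiff ℝ ((⊤ : ℕ∞) : WithTop ℕ∞) f) :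
    ContDiff ℝ ((⊤ : ℕ∞) : WithTop ℕ∞) (deriv f) :=
  (contDiff_infty_iff_deriv.1 hf).2

theorem exists_isAngularProfile (K : ℝ) (hK : 0 ≤ K) : ∃ ℓ₀ : ℕ, ∀ ℓ : ℕ, ℓ₀ ≤ ℓ →
    ∀ κ : ℝ, |κ| ≤ K → ∃ (δ : ℝ) (y : ℝ → ℝ), |δ| ≤ |κ| ∧ IsAngularProfile ℓ κ δ y := by
  obtain ⟨ℓ₀, h⟩ := exists_angular_ground_state K hK
  refine ⟨ℓ₀, fun ℓ hℓ κ hκ => ?_⟩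
  obtain ⟨δ, y, hδ, hy, hpos, hode⟩ := h ℓ hℓ κ hκ
  refine ⟨δ, y, hδ, hy, hpos, fun x hx => ?_⟩
  have h1 : HasDerivAt (fun x : ℝ => 1 - x) (-1) x := by simpa using (hasDerivAt_id x).const_sub 1
  have h2 := ((hasDerivAt_id x).mul (h1.pow (ℓ + 1))).mul
    (hasDerivAt_deriv_of_contDiff (contDiff_deriv_of_contDiff hy) x)
  have h3 := h2.unique (hode x hx)
  have h4 : (1 - x) ^ ℓ ≠ 0 := pow_ne_zero _ (by linarith [hx.2])
  simp only [id, Nat.add_sub_cancel, pow_succ, Pi.mul_apply, Pi.pow_apply] at h3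
  push_cast at h3
  apply mul_left_cancel₀ h4
  linear_combination h3

namespace IsAngularProfile

variable {ℓ : ℕ} {κ δ : ℝ} {y : ℝ → ℝ}

theorem sin_cos_pos {θ : ℝ} (hθ : θ ∈ Ioo 0 (Real.pi / 2)) : 0 < Real.sin θ ∧ 0 < Real.cos θ :=
  ⟨Real.sin_pos_of_pos_of_lt_pi hθ.1 (by linarith [hθ.2, Real.pi_pos]),
    Real.cos_pos_of_mem_Ioo ⟨by linarith [hθ.1, Real.pi_pos], hθ.2⟩⟩

theorem cos_sq_mem (θ : ℝ) : Real.cos θ ^ 2 ∈ Icc (0 : ℝ) 1 :=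
  ⟨sq_nonneg _, Real.cos_sq_le_one θ⟩

theorem cos_sq_mem_Ioo {θ : ℝ} (hθ : θ ∈ Ioo 0 (Real.pi / 2)) :
    Real.cos θ ^ 2 ∈ Ioo (0 : ℝ) 1 := by
  obtain ⟨hs, hc⟩ := sin_cos_pos hθ
  exact ⟨by positivity, by nlinarith [Real.sin_sq_add_cos_sq θ, pow_pos hs 2]⟩

theorem angularMode_pos (hy : IsAngularProfile ℓ κ δ y) {θ : ℝ} (hθ : θ ∈ Ioo 0 (Real.pi / 2)) :
    0 < angularMode ℓ y θ :=
  mul_pos (pow_pos (sin_cos_pos hθ).1 _) (hy.pos _ (cos_sq_mem θ))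

theorem hasDerivAt_cos_sq (θ : ℝ) :
    HasDerivAt (fun θ => Real.cos θ ^ 2) (-(2 * Real.sin θ * Real.cos θ)) θ := by
  refine ((Real.hasDerivAt_cos θ).pow 2).congr_deriv ?_
  push_cast
  ring

theorem hasDerivAt_angularMode (hy : IsAngularProfile ℓ κ δ y) {θ : ℝ} (hθ : Real.sin θ ≠ 0) :
    HasDerivAt (angularMode ℓ y)
      (Real.sin θ ^ ℓ * (ℓ * (Real.cos θ / Real.sin θ) * y (Real.cos θ ^ 2) -
        2 * Real.sin θ * Real.cos θ * deriv y (Real.cos θ ^ 2))) θ := by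
  have h1 := hasDerivAt_pow_of_ne_zero (Real.hasDerivAt_sin θ) hθ ℓ
  have h2 := (hasDerivAt_deriv_of_contDiff hy.contDiff (Real.cos θ ^ 2)).comp θ
    (hasDerivAt_cos_sq θ)
  refine (h1.mul h2).congr_deriv ?_
  simp only [Function.comp]
  ring

theorem sin_two_mul_mul_deriv (hy : IsAngularProfile ℓ κ δ y) {θ : ℝ} (hθ : Real.sin θ ≠ 0) :
    Real.sin (2 * θ) * deriv (angularMode ℓ y) θ =
      Real.sin θ ^ ℓ * (2 * ℓ * Real.cos θ ^ 2 * y (Real.cos θ ^ 2) -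
        4 * Real.sin θ ^ 2 * Real.cos θ ^ 2 * deriv y (Real.cos θ ^ 2)) := by
  rw [(hy.hasDerivAt_angularMode hθ).deriv, Real.sin_two_mul]
  field_simp
  ring

/-- The angular equation for `sin^ℓ θ · y(cos² θ)`, in divergence form. -/
theorem hasDerivAt_sin_two_mul_mul_deriv (hy : IsAngularProfile ℓ κ δ y) {θ : ℝ}
    (hθ : θ ∈ Ioo 0 (Real.pi / 2)) :
    HasDerivAt (fun s => Real.sin (2 * s) * deriv (angularMode ℓ y) s)
      (Real.sin (2 * θ) * (((ℓ : ℝ) ^ 2 / Real.sin θ ^ 2 + κ * Real.cos θ ^ 2 -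
        (ℓ * (ℓ + 2) + δ)) * angularMode ℓ y θ)) θ := by
  have hsin := (sin_cos_pos hθ).1.ne'
  have h1 := hasDerivAt_pow_of_ne_zero (Real.hasDerivAt_sin θ) hsin ℓ
  have hc := hasDerivAt_cos_sq θ
  have hs : HasDerivAt (fun θ => Real.sin θ ^ 2) (2 * Real.sin θ * Real.cos θ) θ := by
    refine ((Real.hasDerivAt_sin θ).pow 2).congr_deriv ?_
    push_cast
    ring
  have h2 := (hasDerivAt_deriv_of_contDiff hy.contDiff (Real.cos θ ^ 2)).comp θ hc
  have h3 := (hasDerivAt_deriv_of_contDiff (contDiff_deriv_of_contDiff hy.contDiff)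
    (Real.cos θ ^ 2)).comp θ hc
  have h4 := h1.mul (((hc.const_mul (2 * (ℓ : ℝ))).mul h2).sub (((hs.const_mul 4).mul hc).mul h3))
  refine (h4.congr_of_eventuallyEq ?_).congr_deriv ?_
  · filter_upwards [isOpen_Ioo.mem_nhds hθ] with s hs
    rw [hy.sin_two_mul_mul_deriv (sin_cos_pos hs).1.ne']
    rfl
  · have hode := hy.ode _ (cos_sq_mem_Ioo hθ)
    have hsc : Real.sin θ ^ 2 = 1 - Real.cos θ ^ 2 := Real.sin_sq θ
    simp only [Function.comp, angularMode, Real.sin_two_mul, Pi.mul_apply, Pi.sub_apply]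
    rw [← hsc] at hode
    generalize deriv (deriv y) (Real.cos θ ^ 2) = y2 at *
    generalize deriv y (Real.cos θ ^ 2) = y1 at *
    generalize y (Real.cos θ ^ 2) = y0 at *
    generalize Real.sin θ ^ ℓ = S at *
    field_simp
    generalize Real.sin θ = s at *
    generalize Real.cos θ = c at *
    linear_combination (8 * S * c * s ^ 2) * hode + (2 * S * c * ℓ ^ 2 * y0) * hsc

/-- Picone's identity. If a regular eigenfunction `v` had a potential everywhere above that of the
positive eigenfunction `u = sin^ℓ θ · y(cos² θ)`, then
`sin 2θ · (v v' - v² u' / u)` would be monotone, strictly where `v ≠ 0`; but it vanishes at both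
end points, because `v(0) = 0` and `sin 2θ · u' / u` stays bounded. -/
theorem not_forall_potential_lt (hy : IsAngularProfile ℓ κ δ y) (hℓ : 1 ≤ ℓ)
    {Q₁ Q₂ Rz lam ω Λ : ℝ} {v : ℝ → ℝ}
    (hv : IsAngularEigenfunction Q₁ Q₂ Rz lam ω (-(ℓ : ℤ)) Λ v) :
    ¬ ∀ θ ∈ Ioo 0 (Real.pi / 2), κ * Real.cos θ ^ 2 - (ℓ * (ℓ + 2) + δ) <
      (lam ^ 2 - ω ^ 2) * (rot Q₁ Q₂ Rz) ^ 2 * Real.cos θ ^ 2 - Λ := by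
  intro hlt
  obtain ⟨⟨θ₀, hθ₀, hv0⟩, ⟨G, hG, hGv⟩, hode⟩ := hv
  have hpi := Real.pi_pos
  -- a globally smooth function that agrees with `v` on the closed interval
  let V : ℝ → ℝ := fun θ => (G ((Real.sin θ : ℂ), (Real.cos θ : ℂ))).re
  have hV : ContDiff ℝ ((⊤ : ℕ∞) : WithTop ℕ∞) V := by
    refine Complex.reCLM.contDiff.comp (hG.comp ?_)
    exact (Complex.ofRealCLM.contDiff.comp Real.contDiff_sin).prodMk
      (Complex.ofRealCLM.contDiff.comp Real.contDiff_cos)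
  have hvV : ∀ θ ∈ Icc 0 (Real.pi / 2), v θ = V θ := by
    intro θ hθ
    have h := hGv θ hθ 0 0
    simp only [mul_zero, Complex.ofReal_zero, Complex.exp_zero, one_mul, mul_one] at h
    simp only [V, ← h, Complex.ofReal_re]
  -- at `θ = 0` rotating the azimuth by `π / ℓ` changes the sign of the mode
  have hV0 : V 0 = 0 := by
    have h0 : (0 : ℝ) ∈ Icc 0 (Real.pi / 2) := ⟨le_rfl, by positivity⟩
    have h1 := hGv 0 h0 0 0
    have h2 := hGv 0 h0 (Real.pi / ℓ) 0
    have hℓ' : (ℓ : ℝ) ≠ 0 := by positivity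
    have h3 : ((-(ℓ : ℤ) : ℤ) : ℝ) * (Real.pi / ℓ) = -Real.pi := by
      push_cast; field_simp
    rw [h3] at h2
    have h4 : Complex.exp (Complex.I * ((-Real.pi : ℝ) : ℂ)) = -1 := by
      have : Complex.I * ((-Real.pi : ℝ) : ℂ) = -(Real.pi * Complex.I) := by push_cast; ring
      rw [this, Complex.exp_neg, Complex.exp_pi_mul_I]
      norm_num
    rw [h4] at h2
    simp only [Real.sin_zero, Complex.ofReal_zero, zero_mul, mul_zero, Complex.exp_zero,
      one_mul] at h1 h2
    rw [← h1] at h2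
    have h5 : (v 0 : ℂ) = 0 := by linear_combination -(1 / 2 : ℂ) * h2
    rw [← hvV 0 h0]
    exact_mod_cast h5
  have hV1 := hasDerivAt_deriv_of_contDiff hV
  have hVs : ContDiff ℝ ((⊤ : ℕ∞) : WithTop ℕ∞) fun s => Real.sin (2 * s) * deriv V s :=
    (Real.contDiff_sin.comp (contDiff_const.mul contDiff_id)).mul (contDiff_deriv_of_contDiff hV)
  have hVode : ∀ θ ∈ Ioo 0 (Real.pi / 2), HasDerivAt (fun s => Real.sin (2 * s) * deriv V s)
      (Real.sin (2 * θ) * (((ℓ : ℝ) ^ 2 / Real.sin θ ^ 2 +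
        (lam ^ 2 - ω ^ 2) * (rot Q₁ Q₂ Rz) ^ 2 * Real.cos θ ^ 2 - Λ) * V θ)) θ := by
    intro θ hθ
    refine (hasDerivAt_deriv_of_contDiff hVs θ).congr_deriv ?_
    have heq : ∀ s ∈ Ioo 0 (Real.pi / 2), deriv v s = deriv V s := fun s hs => by
      refine Filter.EventuallyEq.deriv_eq ?_
      filter_upwards [isOpen_Ioo.mem_nhds hs] with z hz using hvV z (Ioo_subset_Icc_self hz)
    have heq' : deriv (fun s => Real.sin (2 * s) * deriv v s) θ =
        deriv (fun s => Real.sin (2 * s) * deriv V s) θ := by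
      refine Filter.EventuallyEq.deriv_eq ?_
      filter_upwards [isOpen_Ioo.mem_nhds hθ] with z hz
      rw [heq z hz]
    have h := hode θ hθ
    rw [heq', hvV θ (Ioo_subset_Icc_self hθ)] at h
    have hs2 : Real.sin (2 * θ) ≠ 0 := by
      rw [Real.sin_two_mul]
      have := sin_cos_pos hθ
      exact mul_ne_zero (mul_ne_zero two_ne_zero this.1.ne') this.2.ne'
    have hs : Real.sin θ ≠ 0 := (sin_cos_pos hθ).1.ne'
    generalize deriv (fun s => Real.sin (2 * s) * deriv V s) θ = D at h ⊢
    push_cast at h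
    field_simp at h
    field_simp
    linear_combination -h
  let T : ℝ → ℝ := fun θ => 2 * ℓ * Real.cos θ ^ 2 -
    Real.sin (2 * θ) ^ 2 * (deriv y (Real.cos θ ^ 2) / y (Real.cos θ ^ 2))
  have hTc : Continuous T := by
    have h1 := (contDiff_deriv_of_contDiff hy.contDiff).continuous
    have h2 := hy.contDiff.continuous
    have h3 : ∀ θ, y (Real.cos θ ^ 2) ≠ 0 := fun θ => (hy.pos _ (cos_sq_mem θ)).ne'
    fun_prop (disch := assumption)
  have hT : ∀ θ ∈ Ioo 0 (Real.pi / 2),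
      T θ = Real.sin (2 * θ) * deriv (angularMode ℓ y) θ / angularMode ℓ y θ := by
    intro θ hθ
    have hs := (sin_cos_pos hθ).1.ne'
    have h1 := (hy.pos _ (cos_sq_mem θ)).ne'
    have h2 := pow_ne_zero ℓ hs
    rw [hy.sin_two_mul_mul_deriv hs, angularMode]
    simp only [T, Real.sin_two_mul]
    field_simp
    ring
  let φ : ℝ → ℝ := fun θ => Real.sin (2 * θ) * deriv V θ * V θ - V θ ^ 2 * T θ
  have hφc : Continuous φ := by
    have h1 := (contDiff_deriv_of_contDiff hV).continuous
    have h2 := hV.continuous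
    fun_prop
  have hφ0 : φ 0 = 0 := by simp [φ, hV0]
  have hφ1 : φ (Real.pi / 2) = 0 := by
    simp [φ, T, mul_div_cancel₀]
  have hφd : ∀ θ ∈ Ioo 0 (Real.pi / 2), ∃ c > 0, ∃ d ≥ 0, HasDerivAt φ (c * V θ ^ 2 + d) θ := by
    intro θ hθ
    have hu := hy.angularMode_pos hθ
    have hs := (sin_cos_pos hθ).1
    have hP : 0 < Real.sin (2 * θ) := by
      rw [Real.sin_two_mul]
      exact mul_pos (mul_pos two_pos hs) (sin_cos_pos hθ).2
    have hTd := ((hy.hasDerivAt_sin_two_mul_mul_deriv hθ).div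
      (hy.hasDerivAt_angularMode hs.ne').differentiableAt.hasDerivAt hu.ne').congr_of_eventuallyEq
      (f₁ := T) (by filter_upwards [isOpen_Ioo.mem_nhds hθ] with z hz using hT z hz)
    have hφ := ((hVode θ hθ).mul (hV1 θ)).sub (((hV1 θ).pow 2).mul hTd)
    refine ⟨Real.sin (2 * θ) * ((lam ^ 2 - ω ^ 2) * (rot Q₁ Q₂ Rz) ^ 2 * Real.cos θ ^ 2 - Λ -
      (κ * Real.cos θ ^ 2 - (ℓ * (ℓ + 2) + δ))), mul_pos hP (sub_pos.2 (hlt θ hθ)),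
      Real.sin (2 * θ) * (deriv V θ - V θ *
        (deriv (angularMode ℓ y) θ / angularMode ℓ y θ)) ^ 2,
      mul_nonneg hP.le (sq_nonneg _), hφ.congr_deriv ?_⟩
    simp only [Pi.pow_apply, hT θ hθ]
    have hu' := hu.ne'
    have hs' := hs.ne'
    generalize deriv (angularMode ℓ y) θ = u1 at *
    generalize angularMode ℓ y θ = u0 at *
    generalize Real.sin (2 * θ) = P at *
    push_cast
    field_simp
    ring
  have hmono : MonotoneOn φ (Icc 0 (Real.pi / 2)) := by
    refine monotoneOn_of_deriv_nonneg (convex_Icc _ _) hφc.continuousOn ?_ ?_ <;>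
    · rw [interior_Icc]
      intro θ hθ
      obtain ⟨c, hc, d, hd, h⟩ := hφd θ hθ
      first
      | exact h.differentiableAt.differentiableWithinAt
      | rw [h.deriv]; positivity
  have hzero : ∀ θ ∈ Icc 0 (Real.pi / 2), φ θ = 0 := by
    intro θ hθ
    have hb : (0 : ℝ) ≤ Real.pi / 2 := by positivity
    have h1 := hmono ⟨le_rfl, hb⟩ hθ hθ.1
    have h2 := hmono hθ ⟨hb, le_rfl⟩ hθ.2
    rw [hφ0] at h1
    rw [hφ1] at h2
    exact le_antisymm h2 h1
  obtain ⟨c, hc, d, hd, h⟩ := hφd θ₀ hθ₀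
  have h0 : HasDerivAt φ 0 θ₀ := by
    refine (hasDerivAt_const θ₀ (0 : ℝ)).congr_of_eventuallyEq ?_
    filter_upwards [isOpen_Ioo.mem_nhds hθ₀] with z hz using hzero z (Ioo_subset_Icc_self hz)
  have h2 := h.unique h0
  rw [hvV θ₀ (Ioo_subset_Icc_self hθ₀)] at hv0
  have h3 : 0 < V θ₀ ^ 2 := by positivity
  have := mul_pos hc h3
  linarith

/-- The smooth function on `S³ ⊆ ℂ²` given by a profile. -/
theorem contDiff_hopfMode (hy : IsAngularProfile ℓ κ δ y) :
    ContDiff ℝ ((⊤ : ℕ∞) : WithTop ℕ∞)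
      fun z : ℂ × ℂ => (starRingEnd ℂ z.1) ^ ℓ * ((y (‖z.2‖ ^ 2) : ℝ) : ℂ) := by
  refine ((Complex.conjCLE.contDiff.comp contDiff_fst).pow ℓ).mul
    (Complex.ofRealCLM.contDiff.comp (hy.contDiff.comp ?_))
  exact (contDiff_norm_sq ℝ).comp contDiff_snd

theorem hopfMode_eq (y : ℝ → ℝ) (θ φ ψ : ℝ) :
    (starRingEnd ℂ ((Real.sin θ : ℂ) * Complex.exp (Complex.I * (φ : ℂ)))) ^ ℓ *
      ((y (‖(Real.cos θ : ℂ) * Complex.exp (Complex.I * (ψ : ℂ))‖ ^ 2) : ℝ) : ℂ) =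
    Complex.exp (Complex.I * ((((-(ℓ : ℤ) : ℤ) : ℝ) * φ : ℝ) : ℂ)) *
      ((angularMode ℓ y θ : ℝ) : ℂ) := by
  have h1 : ‖(Real.cos θ : ℂ) * Complex.exp (Complex.I * (ψ : ℂ))‖ ^ 2 = Real.cos θ ^ 2 := by
    rw [norm_mul, mul_comm Complex.I, Complex.norm_exp_ofReal_mul_I, mul_one,
      Complex.norm_real, Real.norm_eq_abs, sq_abs]
  rw [h1, map_mul, Complex.conj_ofReal, ← Complex.exp_conj, map_mul, Complex.conj_I,
    Complex.conj_ofReal, mul_pow, ← Complex.exp_nat_mul, angularMode]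
  have h2 : (ℓ : ℂ) * (-Complex.I * (φ : ℂ)) =
      Complex.I * ((((-(ℓ : ℤ) : ℤ) : ℝ) * φ : ℝ) : ℂ) := by
    push_cast; ring
  rw [h2]
  push_cast
  ring

theorem isAngularEigenfunction {Q₁ Q₂ Rz lam ω : ℝ}
    (hy : IsAngularProfile ℓ ((lam ^ 2 - ω ^ 2) * (rot Q₁ Q₂ Rz) ^ 2) δ y) :
    IsAngularEigenfunction Q₁ Q₂ Rz lam ω (-(ℓ : ℤ)) (ℓ * (ℓ + 2) + δ) (angularMode ℓ y) := by
  have hpi := Real.pi_pos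
  have hmid : Real.pi / 4 ∈ Ioo 0 (Real.pi / 2) := ⟨by positivity, by linarith⟩
  refine ⟨⟨_, hmid, (hy.angularMode_pos hmid).ne'⟩,
    ⟨_, hy.contDiff_hopfMode, fun θ _ φ ψ => (hopfMode_eq y θ φ ψ).symm⟩, fun θ hθ => ?_⟩
  rw [(hy.hasDerivAt_sin_two_mul_mul_deriv hθ).deriv]
  have hs2 : Real.sin (2 * θ) ≠ 0 := by
    rw [Real.sin_two_mul]
    have := sin_cos_pos hθ
    exact mul_ne_zero (mul_ne_zero two_ne_zero this.1.ne') this.2.ne'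
  have hs : Real.sin θ ≠ 0 := (sin_cos_pos hθ).1.ne'
  push_cast
  field_simp
  ring

theorem isAngularEigenvalue {Q₁ Q₂ Rz lam ω : ℝ} (hℓ : 1 ≤ ℓ)
    (hy : IsAngularProfile ℓ ((lam ^ 2 - ω ^ 2) * (rot Q₁ Q₂ Rz) ^ 2) δ y) :
    IsAngularEigenvalue Q₁ Q₂ Rz lam ω ℓ (ℓ * (ℓ + 2) + δ) := by
  refine ⟨⟨_, hy.isAngularEigenfunction⟩, ?_⟩
  rintro Λ ⟨v, hv⟩
  by_contra! h
  exact hy.not_forall_potential_lt hℓ hv fun θ _ => by linarith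

/-- The lowest angular eigenvalue depends on the potential in a Lipschitz way. -/
theorem sub_le_of_isAngularProfile {Q₁ Q₂ Rz lam ω δ' : ℝ} {y' : ℝ → ℝ} (hℓ : 1 ≤ ℓ)
    (hy : IsAngularProfile ℓ κ δ y)
    (hy' : IsAngularProfile ℓ ((lam ^ 2 - ω ^ 2) * (rot Q₁ Q₂ Rz) ^ 2) δ' y') :
    δ - δ' ≤ |κ - (lam ^ 2 - ω ^ 2) * (rot Q₁ Q₂ Rz) ^ 2| := by
  by_contra! h
  refine hy.not_forall_potential_lt hℓ hy'.isAngularEigenfunction fun θ _ => ?_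
  have h1 := cos_sq_mem θ
  set κ' := (lam ^ 2 - ω ^ 2) * (rot Q₁ Q₂ Rz) ^ 2
  have h2 : (κ - κ') * Real.cos θ ^ 2 ≤ |κ - κ'| :=
    (mul_le_mul_of_nonneg_right (le_abs_self _) h1.1).trans
      (mul_le_of_le_one_right (abs_nonneg _) h1.2)
  linarith

end IsAngularProfile

/-! ### The radial Dirichlet problem -/

/-- Four times the coefficient of the radial equation `(s^(k+1) (s + a²) w')' = s^k q w`, where
`s = r²`, `u_r = r^k w(r²)`, `Λ` is the angular eigenvalue and `N` stands for `1 / (s + a²)`, which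
has to be replaced by a function smooth on all of `ℝ`. -/
def radialCoeff (a Rz Q lam ω Λ N : ℝ) (k ℓ : ℕ) (s : ℝ) : ℝ :=
  Λ - (ω ^ 2 - lam ^ 2) * (s + Q) - a ^ 2 * (ω * Rz + ℓ) ^ 2 * N - k * (k + 2)

theorem radialCoeff_nonneg {a Rz Q lam N δ K s : ℝ} {k ℓ : ℕ} (hQ : 0 ≤ Q) (hs : 0 ≤ s)
    (hN0 : 0 ≤ N) (hN : N * (s + a ^ 2) = 1) (hδ : |δ| ≤ K) (hℓ : K + k * (k + 2) ≤ ℓ) :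
    0 ≤ radialCoeff a Rz Q lam 0 (ℓ * (ℓ + 2) + δ) N k ℓ s := by
  have h1 : a ^ 2 * N ≤ 1 := by nlinarith
  have h2 : a ^ 2 * (0 * Rz + ℓ) ^ 2 * N ≤ (ℓ : ℝ) ^ 2 := by
    have := mul_le_mul_of_nonneg_left h1 (sq_nonneg (ℓ : ℝ))
    linarith
  have h3 : 0 ≤ lam ^ 2 * (s + Q) := by positivity
  have h4 := (abs_le.mp hδ).1
  have h5 : (0 : ℝ) ≤ ℓ := Nat.cast_nonneg ℓ
  unfold radialCoeff
  nlinarith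

/-- For `ω R_z = 2 B + 2` the radial potential is a well of depth of order `B ℓ` on the interval
`[0, a² / ℓ]`: the centrifugal term `a² (ω R_z + ℓ)² / (s + a²)` exceeds `ℓ²` by
roughly `(2 ω R_z - 1) ℓ` or more. -/
theorem radialCoeff_le {a Rz Q lam ω N δ K B s : ℝ} {k ℓ : ℕ} (hQ : 0 ≤ Q) (hs : 0 ≤ s)
    (ha : 0 < a) (hsℓ : s * ℓ ≤ a ^ 2) (hN : N * (s + a ^ 2) = 1) (hδ : |δ| ≤ K) (hB : 0 ≤ B)
    (hω : ω * Rz = 2 * B + 2) (hℓ1 : 1 ≤ ℓ)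
    (hℓ : K + lam ^ 2 * (a ^ 2 + Q) + (4 * B + 4) ≤ ℓ) :
    radialCoeff a Rz Q lam ω (ℓ * (ℓ + 2) + δ) N k ℓ s ≤ -(4 * B * ℓ) := by
  have hℓ1' : (1 : ℝ) ≤ ℓ := by exact_mod_cast hℓ1
  have ha2 : 0 < a ^ 2 := by positivity
  have hN0 : 0 < N := pos_of_mul_pos_left (by rw [hN]; exact one_pos) (by positivity)
  have hsa : s ≤ a ^ 2 := by nlinarith
  -- `a² / (s + a²) ≥ 1 - 1 / ℓ`
  have h1 : (ℓ : ℝ) - 1 ≤ a ^ 2 * N * ℓ := by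
    have h2 : a ^ 2 * N = 1 - s * N := by linarith
    have h3 : s * N * ℓ ≤ 1 := by
      have : s * ℓ * N ≤ a ^ 2 * N := mul_le_mul_of_nonneg_right hsℓ hN0.le
      nlinarith
    rw [h2]
    linarith
  have h2 : (ℓ : ℝ) * (ℓ + (4 * B + 4)) ≤ (ω * Rz + ℓ) ^ 2 := by
    rw [hω]
    nlinarith
  have h3 : ((ℓ : ℝ) - 1) * (ℓ + (4 * B + 4)) ≤ a ^ 2 * (ω * Rz + ℓ) ^ 2 * N := by
    calc ((ℓ : ℝ) - 1) * (ℓ + (4 * B + 4)) ≤ a ^ 2 * N * ℓ * (ℓ + (4 * B + 4)) :=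
          mul_le_mul_of_nonneg_right h1 (by positivity)
      _ = a ^ 2 * N * (ℓ * (ℓ + (4 * B + 4))) := by ring
      _ ≤ a ^ 2 * N * (ω * Rz + ℓ) ^ 2 := mul_le_mul_of_nonneg_left h2 (by positivity)
      _ = a ^ 2 * (ω * Rz + ℓ) ^ 2 * N := by ring
  have h4 : lam ^ 2 * (s + Q) ≤ lam ^ 2 * (a ^ 2 + Q) :=
    mul_le_mul_of_nonneg_left (by linarith) (sq_nonneg _)
  have h5 : 0 ≤ ω ^ 2 * (s + Q) := by positivity
  have h6 := (abs_le.mp hδ).2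
  have h7 : (0 : ℝ) ≤ k * (k + 2) := by positivity
  unfold radialCoeff
  nlinarith

/-- Sturm comparison with the subsolution `(s₁ - s)²`: in a well of depth `(k + 3)² ℓ` on
`[0, a² / ℓ]` the regular solution cannot stay positive. -/
theorem not_pos_of_well {a : ℝ} {k ℓ : ℕ} (ha : 0 < a) (hℓ : k + 2 ≤ ℓ) {w q : ℝ → ℝ}
    (hw : ContDiff ℝ ((⊤ : ℕ∞) : WithTop ℕ∞) w)
    (hode : ∀ s ∈ Ioo 0 (a ^ 2 / ℓ),
      HasDerivAt (fun s => s ^ (k + 1) * (s + a ^ 2) * deriv w s) (s ^ k * (q s * w s)) s)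
    (hq : ∀ s ∈ Ioo 0 (a ^ 2 / ℓ), q s ≤ -((k + 3) ^ 2 * ℓ)) :
    ¬ ∀ s ∈ Icc 0 (a ^ 2 / ℓ), 0 < w s := by
  intro hpos
  have hℓ' : (k : ℝ) + 2 ≤ ℓ := by exact_mod_cast hℓ
  have hℓ0 : (0 : ℝ) < ℓ := by linarith [(Nat.cast_nonneg k : (0 : ℝ) ≤ k)]
  set s₁ := a ^ 2 / ℓ with hs₁_def
  have hs₁ : 0 < s₁ := by positivity
  have hℓs₁ : ℓ * s₁ = a ^ 2 := by rw [hs₁_def]; field_simp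
  have hk : (0 : ℝ) ≤ k := Nat.cast_nonneg k
  let W : ℝ → ℝ := fun s => -2 * (s₁ - s) * s ^ (k + 1) * (s + a ^ 2) * w s -
    (s₁ - s) ^ 2 * (s ^ (k + 1) * (s + a ^ 2) * deriv w s)
  have hWc : Continuous W := by
    have h1 := hw.continuous
    have h2 := (contDiff_deriv_of_contDiff hw).continuous
    fun_prop
  have hWd : ∀ s ∈ Ioo 0 s₁, 0 < deriv W s := by
    intro s hs
    have h1 : HasDerivAt (fun s => s₁ - s) (-1) s := by
      simpa using (hasDerivAt_id s).const_sub s₁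
    have h2 : HasDerivAt (fun s : ℝ => s ^ (k + 1)) ((k + 1) * s ^ k) s := by
      simpa using hasDerivAt_pow (k + 1) s
    have h3 : HasDerivAt (fun s => s + a ^ 2) 1 s := (hasDerivAt_id s).add_const _
    have h4 := ((((h1.const_mul (-2)).mul h2).mul h3).mul
      (hasDerivAt_deriv_of_contDiff hw s)).sub ((h1.pow 2).mul (hode s hs))
    have h5 : HasDerivAt W (s ^ k * w s * (2 * s * (s + a ^ 2) -
        2 * (s₁ - s) * ((k + 2) * s + (k + 1) * a ^ 2) - q s * (s₁ - s) ^ 2)) s := by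
      refine h4.congr_deriv ?_
      simp only [Pi.mul_apply, Pi.pow_apply]
      push_cast
      ring
    rw [h5.deriv]
    refine mul_pos (mul_pos (pow_pos hs.1 k) (hpos s (Ioo_subset_Icc_self hs))) ?_
    -- `ℓ` times the factor is at least `a⁴ + (a² - (k + 3) ℓ (s₁ - s))²`
    have ht : 0 ≤ s₁ - s := by linarith [hs.2]
    have h6 : (k + 2) * s ≤ a ^ 2 := by
      calc (k + 2) * s ≤ ℓ * s₁ := mul_le_mul hℓ' hs.2.le hs.1.le hℓ0.le
        _ = a ^ 2 := hℓs₁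
    have h7 := mul_le_mul_of_nonneg_left h6 ht
    have h8 := mul_le_mul_of_nonneg_right (hq s hs) (sq_nonneg (s₁ - s))
    have h9 : 0 < s ^ 2 := pow_pos hs.1 2
    have h10 : 0 < 2 * s * a ^ 2 - 2 * (s₁ - s) * ((k + 2) * a ^ 2) +
        (k + 3) ^ 2 * ℓ * (s₁ - s) ^ 2 := by
      refine pos_of_mul_pos_right (a := (ℓ : ℝ)) ?_ hℓ0.le
      have h11 : 0 < a ^ 4 := by positivity
      have h12 : ℓ * (2 * s * a ^ 2 - 2 * (s₁ - s) * ((k + 2) * a ^ 2) +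
          (k + 3) ^ 2 * ℓ * (s₁ - s) ^ 2) =
          a ^ 4 + (a ^ 2 - (k + 3) * ℓ * (s₁ - s)) ^ 2 := by
        linear_combination (2 * a ^ 2) * hℓs₁
      rw [h12]
      positivity
    linarith
  have hmono : StrictMonoOn W (Icc 0 s₁) :=
    strictMonoOn_of_deriv_pos (convex_Icc _ _) hWc.continuousOn (by rwa [interior_Icc])
  have h := hmono ⟨le_rfl, hs₁.le⟩ ⟨hs₁.le, le_rfl⟩ hs₁
  simp [W] at h

/-- A nonnegative solution of the radial equation that is regular at `0` has no zero in the
interior: it would be a double zero. -/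
theorem ne_zero_of_nonneg {a S s₀ : ℝ} {k : ℕ} (ha : 0 < a) {w q : ℝ → ℝ}
    (hw : ContDiff ℝ ((⊤ : ℕ∞) : WithTop ℕ∞) w) (hw0 : w 0 = 1) (hq : ContinuousOn q (Ioo 0 S))
    (hode : ∀ s ∈ Ioo 0 S,
      HasDerivAt (fun s => s ^ (k + 1) * (s + a ^ 2) * deriv w s) (s ^ k * (q s * w s)) s)
    (hnonneg : ∀ s ∈ Ioo 0 S, 0 ≤ w s) (hs₀ : s₀ ∈ Ioo 0 S) : w s₀ ≠ 0 := by
  intro hz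
  have hmin : IsLocalMin w s₀ := by
    filter_upwards [isOpen_Ioo.mem_nhds hs₀] with s hs
    rw [hz]
    exact hnonneg s hs
  have hpos : ∀ t ∈ Ioo 0 S, 0 < t ^ (k + 1) * (t + a ^ 2) := fun t ht =>
    mul_pos (pow_pos ht.1 _) (by have := ht.1; positivity)
  have hzero := eq_zero_of_linear_system (f := w)
    (g := fun s => s ^ (k + 1) * (s + a ^ 2) * deriv w s)
    (α := fun s => (s ^ (k + 1) * (s + a ^ 2))⁻¹) (β := fun s => s ^ k * q s) hs₀
    (ContinuousOn.inv₀ (by fun_prop) fun t ht => (hpos t ht).ne')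
    ((by fun_prop : Continuous fun s : ℝ => s ^ k).continuousOn.mul hq)
    (fun t ht => (hasDerivAt_deriv_of_contDiff hw t).congr_deriv
      (inv_mul_cancel_left₀ (hpos t ht).ne' _).symm)
    (fun t ht => (hode t ht).congr_deriv (by ring)) hz (by simp [hmin.deriv_eq_zero])
  have hS : 0 < S := hs₀.1.trans hs₀.2
  have h1 : ∀ᶠ s in 𝓝[>] (0 : ℝ), 0 < w s :=
    (hw.continuous.continuousAt.eventually (lt_mem_nhds (by rw [hw0]; exact one_pos))).filter_mono
      nhdsWithin_le_nhds
  obtain ⟨s, hs, hs'⟩ := (h1.and (Ioo_mem_nhdsGT hS)).exists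
  exact hs.ne' (hzero s hs')

/-- Shooting for the radial Dirichlet problem. Between `ω = 0`, where the regular solution has no
zero, and `ω = ω₀`, where the potential well at `s ≲ a² / ℓ` forces one, there is a frequency at
which the first zero of the regular solution reaches the boundary `s = R² Λ(ω)`. -/
theorem exists_radial_dirichlet {a Rz Q : ℝ} (ha : 0 < a) (hRz : 0 < Rz) (hQ : 0 ≤ Q) (lam : ℝ)
    (k : ℕ) : ∃ ω₀ : ℝ, 0 ≤ ω₀ ∧ ∀ K R : ℝ, 0 < R → ∃ ℓ₀ : ℕ, ∀ ℓ : ℕ, ℓ₀ ≤ ℓ →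
      ∀ δ : ℝ → ℝ, Continuous δ → (∀ ω, |δ ω| ≤ K) → ∃ ω ∈ Icc 0 ω₀, ∃ w : ℝ → ℝ,
        ContDiff ℝ ((⊤ : ℕ∞) : WithTop ℕ∞) w ∧ w 0 = 1 ∧ w (R ^ 2 * (ℓ * (ℓ + 2) + δ ω)) = 0 ∧
        ∀ s ∈ Ioo 0 (R ^ 2 * (ℓ * (ℓ + 2) + δ ω)),
          HasDerivAt (fun s => s ^ (k + 1) * (s + a ^ 2) * deriv w s)
            (s ^ k * (radialCoeff a Rz Q lam ω (ℓ * (ℓ + 2) + δ ω) (1 / (s + a ^ 2)) k ℓ s / 4 *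
              w s)) s := by
  set B : ℝ := (k + 3) ^ 2 with hB
  have hB0 : 0 ≤ B := by positivity
  have hω₀ : 0 ≤ (2 * B + 2) / Rz := by positivity
  set ω₀ := (2 * B + 2) / Rz with hω₀_def
  refine ⟨ω₀, hω₀, fun K R hR => ?_⟩
  obtain ⟨ℓ₀, hℓ₀⟩ := exists_nat_ge (|K| + k * (k + 2) + lam ^ 2 * (a ^ 2 + Q) + (4 * B + 4) +
    a ^ 2 / R ^ 2)
  refine ⟨ℓ₀ + k + 2, fun ℓ hℓ δ hδc hδ => ?_⟩
  have hℓℓ₀ : (ℓ₀ : ℝ) ≤ ℓ := by exact_mod_cast (by omega : ℓ₀ ≤ ℓ)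
  have hk : (0 : ℝ) ≤ k * (k + 2) := by positivity
  have hlam : 0 ≤ lam ^ 2 * (a ^ 2 + Q) := by positivity
  have haR : 0 ≤ a ^ 2 / R ^ 2 := by positivity
  have hK := le_abs_self K
  have hK' := abs_nonneg K
  have hℓ1 : 1 ≤ ℓ := by omega
  have hℓ1' : (1 : ℝ) ≤ ℓ := by exact_mod_cast hℓ1
  let S : ℝ → ℝ := fun ω => R ^ 2 * (ℓ * (ℓ + 2) + δ ω)
  have hSc : Continuous S := by fun_prop
  have hS : ∀ ω, a ^ 2 / ℓ ≤ S ω := by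
    intro ω
    have h1 := (abs_le.mp (hδ ω)).1
    have h2 : a ^ 2 / R ^ 2 ≤ ℓ := by linarith
    rw [div_le_iff₀ (by positivity)] at h2
    calc a ^ 2 / ℓ ≤ a ^ 2 := div_le_self (by positivity) hℓ1'
      _ ≤ ℓ * R ^ 2 := h2
      _ ≤ (ℓ * (ℓ + 2) + δ ω) * R ^ 2 := by
        refine mul_le_mul_of_nonneg_right ?_ (by positivity)
        nlinarith
      _ = S ω := mul_comm _ _
  have hS0 : ∀ ω, 0 < S ω := fun ω => (by positivity : (0 : ℝ) < a ^ 2 / ℓ).trans_le (hS ω)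
  set M : ℝ := R ^ 2 * (ℓ * (ℓ + 2) + K) + 1 with hM
  have hSM : ∀ ω, S ω < M := by
    intro ω
    have h1 := mul_le_mul_of_nonneg_left (abs_le.mp (hδ ω)).2 (sq_nonneg R)
    simp only [S, hM, mul_add]
    linarith
  obtain ⟨ρ, hρ, hρpos, hρP⟩ := exists_contDiff_mul_eq_one (P := fun s => s + a ^ 2)
    (by fun_prop) (a := 0) (b := M) (fun s hs => by have := hs.1; positivity)
  let q : ℝ → ℝ → ℝ := fun ω s =>
    radialCoeff a Rz Q lam ω (ℓ * (ℓ + 2) + δ ω) (ρ s) k ℓ s / 4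
  have hq : Continuous (Function.uncurry q) := by
    have hρc := hρ.continuous
    change Continuous fun z : ℝ × ℝ =>
      radialCoeff a Rz Q lam z.1 (ℓ * (ℓ + 2) + δ z.1) (ρ z.2) k ℓ z.2 / 4
    unfold radialCoeff
    fun_prop
  have hqs : ∀ ω, ContDiff ℝ ((⊤ : ℕ∞) : WithTop ℕ∞) (q ω) := fun ω => by
    simp only [q, radialCoeff]
    fun_prop
  let w : ℝ → ℝ → ℝ := regularSol k ρ q
  have hw : ∀ ω, ContDiff ℝ ((⊤ : ℕ∞) : WithTop ℕ∞) (w ω) := fun ω =>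
    contDiff_regularSol hρ hq (hqs ω)
  have hw0 : ∀ ω, w ω 0 = 1 := regularSol_zero hρ.continuous hq
  have hode : ∀ ω, ∀ s ∈ Ioo 0 M,
      HasDerivAt (fun s => s ^ (k + 1) * (s + a ^ 2) * deriv (w ω) s)
        (s ^ k * (q ω s * w ω s)) s := fun ω s hs =>
    hasDerivAt_flux_regularSol (P := fun s => s + a ^ 2) hρ.continuous hq (by
      filter_upwards [isOpen_Ioo.mem_nhds hs] with σ hσ using hρP σ (Ioo_subset_Icc_self hσ))
  have hmem : ∀ ω, ∀ x ∈ Icc (0 : ℝ) 1, x * S ω ∈ Icc 0 (S ω) := fun ω x hx =>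
    ⟨mul_nonneg hx.1 (hS0 ω).le, mul_le_of_le_one_left (hS0 ω).le hx.2⟩
  have hmem' : ∀ ω, ∀ s ∈ Icc 0 (S ω), s / S ω ∈ Icc (0 : ℝ) 1 := fun ω s hs =>
    ⟨div_nonneg hs.1 (hS0 ω).le, (div_le_one (hS0 ω)).2 hs.2⟩
  obtain ⟨ω, hω, x, hx, hFx, hFnonneg⟩ := exists_touching_zero
    (F := fun ω x => w ω (x * S ω)) hω₀
    (((continuous_regularSol hρ.continuous hq).comp
      (by fun_prop : Continuous fun z : ℝ × ℝ => (z.1, z.2 * S z.1))).continuousOn)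
    (fun x hx => by
      refine one_pos.trans_le (one_le_regularSol hρ.continuous hq (S := S 0)
        (fun s _ => (hρpos s).le) (fun s hs => ?_) _ (hmem 0 x hx))
      refine div_nonneg (radialCoeff_nonneg hQ hs.1 (hρpos s).le
        (hρP s ⟨hs.1, hs.2.trans (hSM 0).le⟩) (hδ 0) ?_) (by norm_num)
      linarith)
    (by
      by_contra! hneg
      refine not_pos_of_well (ℓ := ℓ) ha (by omega) (hw ω₀) (q := q ω₀) (k := k)
        (fun s hs => hode ω₀ s ⟨hs.1, hs.2.trans ((hS ω₀).trans_lt (hSM ω₀))⟩)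
        (fun s hs => ?_) (fun s hs => ?_)
      · have h := radialCoeff_le (k := k) (lam := lam) hQ hs.1.le ha
          ((le_div_iff₀ (by positivity)).1 hs.2.le)
          (hρP s ⟨hs.1.le, hs.2.le.trans ((hS ω₀).trans (hSM ω₀).le)⟩) (hδ ω₀) hB0
          (div_mul_cancel₀ _ hRz.ne') hℓ1 (by linarith)
        simp only [q]
        linarith
      · have h := hneg _ (hmem' ω₀ s ⟨hs.1, hs.2.trans (hS ω₀)⟩)
        rwa [div_mul_cancel₀ _ (hS0 ω₀).ne'] at h)
  refine ⟨ω, hω, w ω, hw ω, hw0 ω, ?_, fun s hs => ?_⟩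
  · rcases eq_or_lt_of_le hx.2 with h1 | h1
    · simp only [h1, one_mul] at hFx
      exact hFx
    · exfalso
      have hx0 : 0 < x := by
        refine lt_of_le_of_ne hx.1 fun h => ?_
        rw [← h, zero_mul, hw0] at hFx
        exact one_ne_zero hFx
      refine ne_zero_of_nonneg (k := k) (S := S ω) ha (hw ω) (hw0 ω)
        (hqs ω).continuous.continuousOn
        (fun s hs => hode ω s ⟨hs.1, hs.2.trans (hSM ω)⟩) (fun s hs => ?_)
        ⟨mul_pos hx0 (hS0 ω), mul_lt_of_lt_one_left (hS0 ω) h1⟩ hFx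
      have h := hFnonneg _ (hmem' ω s (Ioo_subset_Icc_self hs))
      rwa [div_mul_cancel₀ _ (hS0 ω).ne'] at h
  · have hsM : s < M := hs.2.trans (hSM ω)
    refine (hode ω s ⟨hs.1, hsM⟩).congr_deriv ?_
    simp only [q]
    rw [← eq_one_div_of_mul_eq_one_left (hρP s ⟨hs.1.le, hsM.le⟩)]

/-! ### The inverse metric and its symbol -/

/-- The determinant of a matrix with the sparsity pattern of the metric. -/
theorem det_block (a b c d e f g k : ℝ) :
    (!![a, 0, 0, 0, b, 0;
        0, c, 0, 0, 0, d;
        0, 0, e, 0, 0, 0;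
        0, 0, 0, f, 0, 0;
        b, 0, 0, 0, g, 0;
        0, d, 0, 0, 0, k] : Matrix (Fin 6) (Fin 6) ℝ).det =
      (a * g - b ^ 2) * (c * k - d ^ 2) * (e * f) := by
  simp [Matrix.det_succ_row_zero, Fin.sum_univ_succ, Fin.succAbove, Matrix.submatrix]
  ring

/-- The inverse of a matrix with the sparsity pattern of the metric. -/
theorem inv_block {a b c d e f g k : ℝ} (h₁ : a * g - b ^ 2 ≠ 0) (h₂ : c * k - d ^ 2 ≠ 0)
    (he : e ≠ 0) (hf : f ≠ 0) :
    (!![a, 0, 0, 0, b, 0;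
        0, c, 0, 0, 0, d;
        0, 0, e, 0, 0, 0;
        0, 0, 0, f, 0, 0;
        b, 0, 0, 0, g, 0;
        0, d, 0, 0, 0, k] : Matrix (Fin 6) (Fin 6) ℝ)⁻¹ =
      !![g / (a * g - b ^ 2), 0, 0, 0, -b / (a * g - b ^ 2), 0;
        0, k / (c * k - d ^ 2), 0, 0, 0, -d / (c * k - d ^ 2);
        0, 0, e⁻¹, 0, 0, 0;
        0, 0, 0, f⁻¹, 0, 0;
        -b / (a * g - b ^ 2), 0, 0, 0, a / (a * g - b ^ 2), 0;
        0, -d / (c * k - d ^ 2), 0, 0, 0, c / (c * k - d ^ 2)] := by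
  refine Matrix.inv_eq_right_inv ?_
  ext i j
  fin_cases i <;> fin_cases j <;>
    simp [Matrix.mul_apply, Fin.sum_univ_succ, he, hf] <;> field_simp <;> ring

section Geometry

variable {Q₁ Q₂ Rz r θ : ℝ}

theorem rot_pos (hQ₁ : 0 < Q₁) (hQ₂ : 0 < Q₂) (hRz : 0 < Rz) : 0 < rot Q₁ Q₂ Rz :=
  div_pos (Real.sqrt_pos.2 (mul_pos hQ₁ hQ₂)) hRz

theorem fFun_pos (hr : 0 < r) : 0 < fFun Q₁ Q₂ Rz r θ := by
  unfold fFun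
  positivity

theorem hFun_pos (hQ₁ : 0 < Q₁) (hQ₂ : 0 < Q₂) (hr : 0 < r) : 0 < hFun Q₁ Q₂ Rz r θ := by
  have := fFun_pos (Q₁ := Q₁) (Q₂ := Q₂) (Rz := Rz) (θ := θ) hr
  unfold hFun
  positivity

theorem hFun_sq_mul (hQ₁ : 0 < Q₁) (hQ₂ : 0 < Q₂) (hr : 0 < r) :
    hFun Q₁ Q₂ Rz r θ ^ 2 * fFun Q₁ Q₂ Rz r θ ^ 2 =
      (fFun Q₁ Q₂ Rz r θ + Q₁) * (fFun Q₁ Q₂ Rz r θ + Q₂) := by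
  have := fFun_pos (Q₁ := Q₁) (Q₂ := Q₂) (Rz := Rz) (θ := θ) hr
  rw [hFun, Real.sq_sqrt (by positivity)]
  field_simp

/-- The density `√|det g|`. -/
noncomputable def volDensity (Q₁ Q₂ Rz r θ : ℝ) : ℝ :=
  r * Real.sin θ * Real.cos θ * (hFun Q₁ Q₂ Rz r θ * fFun Q₁ Q₂ Rz r θ)

/-- The components `g^{μν}` of the inverse metric in the coordinates `(t, z, r, θ, φ, ψ)`. -/
noncomputable def invMetric (Q₁ Q₂ Rz r θ : ℝ) : Matrix (Fin 6) (Fin 6) ℝ :=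
  let a := rot Q₁ Q₂ Rz
  let f := fFun Q₁ Q₂ Rz r θ
  let h := hFun Q₁ Q₂ Rz r θ
  let gtt := -(h * (r ^ 2 + a ^ 2 - a ^ 2 * Q₁ * Q₂ * Real.sin θ ^ 2 / (h ^ 2 * f ^ 2)) /
    (r ^ 2 + a ^ 2))
  let gtφ := -(a * Real.sqrt (Q₁ * Q₂) / (h * f * (r ^ 2 + a ^ 2)))
  let gφφ := 1 / (h * (r ^ 2 + a ^ 2) * Real.sin θ ^ 2)
  let gzz := h * (r ^ 2 + a ^ 2 * Q₁ * Q₂ * Real.cos θ ^ 2 / (h ^ 2 * f ^ 2)) / r ^ 2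
  let gzψ := a * Real.sqrt (Q₁ * Q₂) / (h * f * r ^ 2)
  let gψψ := 1 / (h * r ^ 2 * Real.cos θ ^ 2)
  !![gtt, 0,   0,   0,   gtφ, 0;
     0,   gzz, 0,   0,   0,   gzψ;
     0,   0,   (r ^ 2 + a ^ 2) / (h * f), 0,   0,   0;
     0,   0,   0,   1 / (h * f), 0,   0;
     gtφ, 0,   0,   0,   gφφ, 0;
     0,   gzψ, 0,   0,   0,   gψψ]

theorem det_tφ_block (hQ₁ : 0 < Q₁) (hQ₂ : 0 < Q₂) {a h f s : ℝ} (hh : h ≠ 0) (hf : f ≠ 0) :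
    -(1 / h) * (h * (r ^ 2 + a ^ 2 - a ^ 2 * Q₁ * Q₂ * s ^ 2 / (h ^ 2 * f ^ 2)) * s ^ 2) -
      (-(a * Real.sqrt (Q₁ * Q₂) / (h * f) * s ^ 2)) ^ 2 = -((r ^ 2 + a ^ 2) * s ^ 2) := by
  have hS := Real.sq_sqrt (mul_pos hQ₁ hQ₂).le
  generalize Real.sqrt (Q₁ * Q₂) = S at *
  field_simp
  linear_combination (-a ^ 2 * s ^ 4) * hS

theorem det_zψ_block (hQ₁ : 0 < Q₁) (hQ₂ : 0 < Q₂) {a h f c : ℝ} (hh : h ≠ 0) (hf : f ≠ 0) :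
    1 / h * (h * (r ^ 2 + a ^ 2 * Q₁ * Q₂ * c ^ 2 / (h ^ 2 * f ^ 2)) * c ^ 2) -
      (-(a * Real.sqrt (Q₁ * Q₂) / (h * f) * c ^ 2)) ^ 2 = r ^ 2 * c ^ 2 := by
  have hS := Real.sq_sqrt (mul_pos hQ₁ hQ₂).le
  generalize Real.sqrt (Q₁ * Q₂) = S at *
  field_simp
  linear_combination (-a ^ 2 * c ^ 4) * hS

end Geometry

section

variable {Q₁ Q₂ Rz : ℝ} {x : Fin 6 → ℝ}

theorem sqrt_abs_det_metric (hQ₁ : 0 < Q₁) (hQ₂ : 0 < Q₂) (hRz : 0 < Rz) (hr : 0 < x 2)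
    (hθ : x 3 ∈ Ioo 0 (Real.pi / 2)) :
    Real.sqrt |(metric Q₁ Q₂ Rz x).det| = volDensity Q₁ Q₂ Rz (x 2) (x 3) := by
  have ha := rot_pos hQ₁ hQ₂ hRz
  have hf := fFun_pos (Q₁ := Q₁) (Q₂ := Q₂) (Rz := Rz) (θ := x 3) hr
  have hh := hFun_pos (Rz := Rz) (θ := x 3) hQ₁ hQ₂ hr
  obtain ⟨hs, hc⟩ := IsAngularProfile.sin_cos_pos hθ
  have hdet : (metric Q₁ Q₂ Rz x).det = -(volDensity Q₁ Q₂ Rz (x 2) (x 3)) ^ 2 := by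
    unfold metric
    rw [det_block, det_tφ_block hQ₁ hQ₂ hh.ne' hf.ne', det_zψ_block hQ₁ hQ₂ hh.ne' hf.ne',
      volDensity]
    field_simp
  rw [hdet, abs_neg, abs_of_nonneg (sq_nonneg _), Real.sqrt_sq]
  unfold volDensity
  positivity

theorem inv_metric (hQ₁ : 0 < Q₁) (hQ₂ : 0 < Q₂) (hRz : 0 < Rz) (hr : 0 < x 2)
    (hθ : x 3 ∈ Ioo 0 (Real.pi / 2)) :
    (metric Q₁ Q₂ Rz x)⁻¹ = invMetric Q₁ Q₂ Rz (x 2) (x 3) := by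
  have ha := rot_pos hQ₁ hQ₂ hRz
  have hf := fFun_pos (Q₁ := Q₁) (Q₂ := Q₂) (Rz := Rz) (θ := x 3) hr
  have hh := hFun_pos (Rz := Rz) (θ := x 3) hQ₁ hQ₂ hr
  obtain ⟨hs, hc⟩ := IsAngularProfile.sin_cos_pos hθ
  have hD₁ : (0 : ℝ) < (x 2 ^ 2 + rot Q₁ Q₂ Rz ^ 2) * Real.sin (x 3) ^ 2 := by positivity
  have hD₂ : (0 : ℝ) < x 2 ^ 2 * Real.cos (x 3) ^ 2 := by positivity
  unfold metric invMetric
  rw [inv_block, det_tφ_block hQ₁ hQ₂ hh.ne' hf.ne', det_zψ_block hQ₁ hQ₂ hh.ne' hf.ne']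
  · ext i j
    fin_cases i <;> fin_cases j <;>
      simp only [Fin.reduceFinMk, Fin.zero_eta, Fin.mk_one, Matrix.of_apply, Matrix.cons_val',
        Matrix.cons_val, Matrix.cons_val_zero, Matrix.cons_val_one] <;> field_simp
  · rw [det_tφ_block hQ₁ hQ₂ hh.ne' hf.ne']
    exact (neg_neg_of_pos hD₁).ne
  · rw [det_zψ_block hQ₁ hQ₂ hh.ne' hf.ne']
    exact hD₂.ne'
  · positivity
  · positivity

/-- The algebraic identity behind the separation of variables: `h f` times the symbol of the wave
operator in the directions `t, z, φ` splits into a function of `r` and a function of `θ`. -/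
theorem symbol_separates {r θ ω lam m : ℝ} (hQ₁ : 0 < Q₁) (hQ₂ : 0 < Q₂) (hRz : 0 < Rz)
    (hr : 0 < r) (hθ : θ ∈ Ioo 0 (Real.pi / 2)) :
    hFun Q₁ Q₂ Rz r θ * fFun Q₁ Q₂ Rz r θ *
      (ω ^ 2 * invMetric Q₁ Q₂ Rz r θ 0 0 - 2 * ω * m * invMetric Q₁ Q₂ Rz r θ 0 4 +
        m ^ 2 * invMetric Q₁ Q₂ Rz r θ 4 4 + lam ^ 2 * invMetric Q₁ Q₂ Rz r θ 1 1) =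
      -((ω ^ 2 - lam ^ 2) * (r ^ 2 + (Q₁ + Q₂))) -
        rot Q₁ Q₂ Rz ^ 2 * (ω * Rz - m) ^ 2 / (r ^ 2 + rot Q₁ Q₂ Rz ^ 2) +
        rot Q₁ Q₂ Rz ^ 2 * (lam * Rz) ^ 2 / r ^ 2 +
        (m ^ 2 / Real.sin θ ^ 2 + (lam ^ 2 - ω ^ 2) * rot Q₁ Q₂ Rz ^ 2 * Real.cos θ ^ 2) := by
  have ha := rot_pos hQ₁ hQ₂ hRz
  have hf := fFun_pos (Q₁ := Q₁) (Q₂ := Q₂) (Rz := Rz) (θ := θ) hr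
  have hh := hFun_pos (Rz := Rz) (θ := θ) hQ₁ hQ₂ hr
  have hhf := hFun_sq_mul (Rz := Rz) (θ := θ) hQ₁ hQ₂ hr
  obtain ⟨hs, hc⟩ := IsAngularProfile.sin_cos_pos hθ
  have hS : Real.sqrt (Q₁ * Q₂) = rot Q₁ Q₂ Rz * Rz := by rw [rot]; field_simp
  have hS2 : Q₁ * Q₂ = (rot Q₁ Q₂ Rz * Rz) ^ 2 := by
    rw [← hS, Real.sq_sqrt (mul_pos hQ₁ hQ₂).le]
  have hsc : Real.sin θ ^ 2 = 1 - Real.cos θ ^ 2 := Real.sin_sq θ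
  have hfd : fFun Q₁ Q₂ Rz r θ = r ^ 2 + rot Q₁ Q₂ Rz ^ 2 * Real.cos θ ^ 2 := rfl
  have hP : 0 < r ^ 2 + rot Q₁ Q₂ Rz ^ 2 := by positivity
  have e00 : hFun Q₁ Q₂ Rz r θ * fFun Q₁ Q₂ Rz r θ * invMetric Q₁ Q₂ Rz r θ 0 0 =
      -(fFun Q₁ Q₂ Rz r θ + Q₁ + Q₂ + Q₁ * Q₂ / (r ^ 2 + rot Q₁ Q₂ Rz ^ 2)) := by
    simp only [invMetric, Matrix.of_apply, Matrix.cons_val', Matrix.cons_val_zero]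
    generalize hFun Q₁ Q₂ Rz r θ = h at *
    generalize fFun Q₁ Q₂ Rz r θ = f at *
    field_simp
    linear_combination -(r ^ 2 + rot Q₁ Q₂ Rz ^ 2) * hhf + Q₁ * Q₂ * hfd +
      rot Q₁ Q₂ Rz ^ 2 * Q₁ * Q₂ * hsc
  have e04 : hFun Q₁ Q₂ Rz r θ * fFun Q₁ Q₂ Rz r θ * invMetric Q₁ Q₂ Rz r θ 0 4 =
      -(rot Q₁ Q₂ Rz ^ 2 * Rz / (r ^ 2 + rot Q₁ Q₂ Rz ^ 2)) := by
    simp only [invMetric, Matrix.of_apply, Matrix.cons_val', Matrix.cons_val_zero, Matrix.cons_val]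
    rw [hS]
    field_simp
  have e44 : hFun Q₁ Q₂ Rz r θ * fFun Q₁ Q₂ Rz r θ * invMetric Q₁ Q₂ Rz r θ 4 4 =
      1 / Real.sin θ ^ 2 - rot Q₁ Q₂ Rz ^ 2 / (r ^ 2 + rot Q₁ Q₂ Rz ^ 2) := by
    simp only [invMetric, Matrix.of_apply, Matrix.cons_val', Matrix.cons_val]
    field_simp
    rw [hfd]
    linear_combination (rot Q₁ Q₂ Rz ^ 2) * hsc
  have e11 : hFun Q₁ Q₂ Rz r θ * fFun Q₁ Q₂ Rz r θ * invMetric Q₁ Q₂ Rz r θ 1 1 =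
      fFun Q₁ Q₂ Rz r θ + Q₁ + Q₂ + Q₁ * Q₂ / r ^ 2 := by
    simp only [invMetric, Matrix.of_apply, Matrix.cons_val', Matrix.cons_val]
    generalize hFun Q₁ Q₂ Rz r θ = h at *
    generalize fFun Q₁ Q₂ Rz r θ = f at *
    field_simp
    linear_combination r ^ 2 * hhf - Q₁ * Q₂ * hfd
  calc _ = ω ^ 2 * (hFun Q₁ Q₂ Rz r θ * fFun Q₁ Q₂ Rz r θ * invMetric Q₁ Q₂ Rz r θ 0 0) -
        2 * ω * m * (hFun Q₁ Q₂ Rz r θ * fFun Q₁ Q₂ Rz r θ * invMetric Q₁ Q₂ Rz r θ 0 4) +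
        m ^ 2 * (hFun Q₁ Q₂ Rz r θ * fFun Q₁ Q₂ Rz r θ * invMetric Q₁ Q₂ Rz r θ 4 4) +
        lam ^ 2 * (hFun Q₁ Q₂ Rz r θ * fFun Q₁ Q₂ Rz r θ * invMetric Q₁ Q₂ Rz r θ 1 1) := by ring
    _ = _ := by
      rw [e00, e04, e44, e11, hS2, hfd]
      field_simp
      ring

end

/-! ### Separation of the wave equation -/

/-- The oscillating factor of a mode with `m_ψ = 0`. -/
noncomputable def phase (ω lam : ℝ) (m : ℤ) (x : Fin 6 → ℝ) : ℂ :=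
  Complex.exp (Complex.I * ((-(ω * x 0) + lam * x 1 + (m : ℝ) * x 4 : ℝ) : ℂ))

section

variable {ω lam : ℝ} {m : ℤ} {ur uθ : ℝ → ℝ}

theorem mode_eq_phase (x : Fin 6 → ℝ) :
    mode ω lam m 0 ur uθ x = phase ω lam m x * (ur (x 2) : ℂ) * (uθ (x 3) : ℂ) := by
  simp [mode, phase]

theorem hasDerivAt_of_update_exp {u : (Fin 6 → ℝ) → ℂ} {i : Fin 6} {α : ℝ} {x : Fin 6 → ℝ}
    (h : ∀ s, u (Function.update x i s) =
      Complex.exp (Complex.I * ((α * (s - x i) : ℝ) : ℂ)) * u x) :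
    HasDerivAt (fun s => u (Function.update x i s)) (Complex.I * α * u x) (x i) := by
  have h1 : HasDerivAt (fun s : ℝ => ((α * (s - x i) : ℝ) : ℂ)) ((α : ℝ) : ℂ) (x i) := by
    refine HasDerivAt.ofReal_comp ?_
    simpa using ((hasDerivAt_id (x i)).sub_const (x i)).const_mul α
  have h2 := ((h1.const_mul Complex.I).cexp).mul_const (u x)
  rw [funext h]
  refine h2.congr_deriv ?_
  simp

theorem mode_update_exp (i : Fin 6) (α : ℝ) (hi : i ≠ 2) (hi' : i ≠ 3) {x : Fin 6 → ℝ}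
    (hα : ∀ s, -(ω * Function.update x i s 0) + lam * Function.update x i s 1 +
      (m : ℝ) * Function.update x i s 4 =
      α * (s - x i) + (-(ω * x 0) + lam * x 1 + (m : ℝ) * x 4)) (s : ℝ) :
    mode ω lam m 0 ur uθ (Function.update x i s) =
      Complex.exp (Complex.I * ((α * (s - x i) : ℝ) : ℂ)) * mode ω lam m 0 ur uθ x := by
  rw [mode_eq_phase, mode_eq_phase, Function.update_of_ne hi.symm, Function.update_of_ne hi'.symm,
    phase, hα, phase, Complex.ofReal_add, mul_add, Complex.exp_add]
  ring

theorem hasDerivAt_mode_t (x : Fin 6 → ℝ) :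
    HasDerivAt (fun s => mode ω lam m 0 ur uθ (Function.update x 0 s))
      (Complex.I * (-ω : ℝ) * mode ω lam m 0 ur uθ x) (x 0) :=
  hasDerivAt_of_update_exp (mode_update_exp 0 (-ω) (by decide) (by decide) fun s => by
    simp [Function.update]; ring)

theorem hasDerivAt_mode_z (x : Fin 6 → ℝ) :
    HasDerivAt (fun s => mode ω lam m 0 ur uθ (Function.update x 1 s))
      (Complex.I * (lam : ℝ) * mode ω lam m 0 ur uθ x) (x 1) :=
  hasDerivAt_of_update_exp (mode_update_exp 1 lam (by decide) (by decide) fun s => by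
    simp [Function.update]; ring)

theorem hasDerivAt_mode_φ (x : Fin 6 → ℝ) :
    HasDerivAt (fun s => mode ω lam m 0 ur uθ (Function.update x 4 s))
      (Complex.I * ((m : ℝ) : ℂ) * mode ω lam m 0 ur uθ x) (x 4) :=
  hasDerivAt_of_update_exp (mode_update_exp 4 m (by decide) (by decide) fun s => by
    simp [Function.update]; ring)

theorem hasDerivAt_mode_ψ (x : Fin 6 → ℝ) :
    HasDerivAt (fun s => mode ω lam m 0 ur uθ (Function.update x 5 s)) 0 (x 5) := by
  have := hasDerivAt_of_update_exp (u := mode ω lam m 0 ur uθ) (α := 0) (x := x)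
    (mode_update_exp 5 0 (by decide) (by decide) fun s => by simp [Function.update])
  simpa using this

theorem partialDeriv_mode_r (hur : Differentiable ℝ ur) (x : Fin 6 → ℝ) :
    partialDeriv 2 (mode ω lam m 0 ur uθ) x =
      phase ω lam m x * ((deriv ur (x 2) : ℝ) : ℂ) * (uθ (x 3) : ℂ) := by
  have h : (fun s => mode ω lam m 0 ur uθ (Function.update x 2 s)) =
      fun s => phase ω lam m x * (ur s : ℂ) * (uθ (x 3) : ℂ) := by
    ext s
    rw [mode_eq_phase]
    simp [phase, Function.update]
  rw [partialDeriv, h]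
  exact (((hur (x 2)).hasDerivAt.ofReal_comp.const_mul _).mul_const _).deriv

theorem partialDeriv_mode_θ (huθ : Differentiable ℝ uθ) (x : Fin 6 → ℝ) :
    partialDeriv 3 (mode ω lam m 0 ur uθ) x =
      phase ω lam m x * (ur (x 2) : ℂ) * ((deriv uθ (x 3) : ℝ) : ℂ) := by
  have h : (fun s => mode ω lam m 0 ur uθ (Function.update x 3 s)) =
      fun s => phase ω lam m x * (ur (x 2) : ℂ) * (uθ s : ℂ) := by
    ext s
    rw [mode_eq_phase]
    simp [phase, Function.update]
  rw [partialDeriv, h]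
  exact ((huθ (x 3)).hasDerivAt.ofReal_comp.const_mul _).deriv

/-- Separation of variables for the wave equation: a product of solutions of the radial and the
angular equation is a solution. -/
theorem waveOp_mode_eq_zero {Q₁ Q₂ Rz Λ : ℝ} (hQ₁ : 0 < Q₁) (hQ₂ : 0 < Q₂) (hRz : 0 < Rz)
    (hur : Differentiable ℝ ur) (huθ : Differentiable ℝ uθ) {x : Fin 6 → ℝ} (hr : 0 < x 2)
    (hθ : x 3 ∈ Ioo 0 (Real.pi / 2))
    (hodeᵣ : HasDerivAt (fun r => r * (r ^ 2 + rot Q₁ Q₂ Rz ^ 2) * deriv ur r)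
      (x 2 * ((Λ - (ω ^ 2 - lam ^ 2) * (x 2 ^ 2 + (Q₁ + Q₂)) -
        rot Q₁ Q₂ Rz ^ 2 * (ω * Rz - m) ^ 2 / (x 2 ^ 2 + rot Q₁ Q₂ Rz ^ 2) +
        rot Q₁ Q₂ Rz ^ 2 * (lam * Rz) ^ 2 / x 2 ^ 2) * ur (x 2))) (x 2))
    (hodeθ : HasDerivAt (fun s => Real.sin (2 * s) * deriv uθ s)
      (Real.sin (2 * x 3) * (((m : ℝ) ^ 2 / Real.sin (x 3) ^ 2 +
        (lam ^ 2 - ω ^ 2) * rot Q₁ Q₂ Rz ^ 2 * Real.cos (x 3) ^ 2 - Λ) * uθ (x 3))) (x 3)) :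
    waveOp (metric Q₁ Q₂ Rz) (mode ω lam m 0 ur uθ) x = 0 := by
  set u := mode ω lam m 0 ur uθ with hu
  let D := volDensity Q₁ Q₂ Rz
  let g := invMetric Q₁ Q₂ Rz
  obtain ⟨hs, hc⟩ := IsAngularProfile.sin_cos_pos hθ
  have hf := fFun_pos (Q₁ := Q₁) (Q₂ := Q₂) (Rz := Rz) (θ := x 3) hr
  have hh := hFun_pos (Rz := Rz) (θ := x 3) hQ₁ hQ₂ hr
  -- the components of the flux `√|det g| g^{ij} ∂_j u`
  have hflux : ∀ (i : Fin 6) (y : Fin 6 → ℝ), 0 < y 2 → y 3 ∈ Ioo 0 (Real.pi / 2) →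
      ((Real.sqrt |(metric Q₁ Q₂ Rz y).det| : ℝ) : ℂ) *
        ∑ j, (((metric Q₁ Q₂ Rz y)⁻¹ i j : ℝ) : ℂ) * partialDeriv j u y =
      (D (y 2) (y 3) : ℂ) * ((g (y 2) (y 3) i 0 : ℂ) * (Complex.I * (-ω : ℝ) * u y) +
        (g (y 2) (y 3) i 1 : ℂ) * (Complex.I * (lam : ℝ) * u y) +
        (g (y 2) (y 3) i 2 : ℂ) * (phase ω lam m y * ((deriv ur (y 2) : ℝ) : ℂ) * (uθ (y 3) : ℂ)) +
        (g (y 2) (y 3) i 3 : ℂ) * (phase ω lam m y * (ur (y 2) : ℂ) * ((deriv uθ (y 3) : ℝ) : ℂ)) +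
        (g (y 2) (y 3) i 4 : ℂ) * (Complex.I * ((m : ℝ) : ℂ) * u y)) := by
    intro i y hy2 hy3
    rw [sqrt_abs_det_metric hQ₁ hQ₂ hRz hy2 hy3, inv_metric hQ₁ hQ₂ hRz hy2 hy3,
      Fin.sum_univ_six, partialDeriv_mode_r hur, partialDeriv_mode_θ huθ]
    have h0 : partialDeriv 0 u y = _ := (hasDerivAt_mode_t y).deriv
    have h1 : partialDeriv 1 u y = _ := (hasDerivAt_mode_z y).deriv
    have h4 : partialDeriv 4 u y = _ := (hasDerivAt_mode_φ y).deriv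
    have h5 : partialDeriv 5 u y = 0 := (hasDerivAt_mode_ψ y).deriv
    rw [h0, h1, h4, h5]
    ring
  -- the flux in a cyclic direction is a multiple of `u`
  have hcyc : ∀ (i : Fin 6) (c : ℂ), i ≠ 2 → i ≠ 3 →
      g (x 2) (x 3) i 2 = 0 → g (x 2) (x 3) i 3 = 0 →
      HasDerivAt (fun s => u (Function.update x i s)) c (x i) →
      partialDeriv i (fun y => ((Real.sqrt |(metric Q₁ Q₂ Rz y).det| : ℝ) : ℂ) *
        ∑ j, (((metric Q₁ Q₂ Rz y)⁻¹ i j : ℝ) : ℂ) * partialDeriv j u y) x =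
      (D (x 2) (x 3) : ℂ) * ((g (x 2) (x 3) i 0 : ℂ) * (Complex.I * (-ω : ℝ)) +
        (g (x 2) (x 3) i 1 : ℂ) * (Complex.I * (lam : ℝ)) +
        (g (x 2) (x 3) i 4 : ℂ) * (Complex.I * ((m : ℝ) : ℂ))) * c := by
    intro i c hi2 hi3 hg2 hg3 hd
    have h : (fun s => (fun y => ((Real.sqrt |(metric Q₁ Q₂ Rz y).det| : ℝ) : ℂ) *
        ∑ j, (((metric Q₁ Q₂ Rz y)⁻¹ i j : ℝ) : ℂ) * partialDeriv j u y)
        (Function.update x i s)) = fun s =>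
        (D (x 2) (x 3) : ℂ) * ((g (x 2) (x 3) i 0 : ℂ) * (Complex.I * (-ω : ℝ)) +
        (g (x 2) (x 3) i 1 : ℂ) * (Complex.I * (lam : ℝ)) +
        (g (x 2) (x 3) i 4 : ℂ) * (Complex.I * ((m : ℝ) : ℂ))) *
        u (Function.update x i s) := by
      ext s
      have e2 : Function.update x i s 2 = x 2 := Function.update_of_ne hi2.symm _ _
      have e3 : Function.update x i s 3 = x 3 := Function.update_of_ne hi3.symm _ _
      have := hflux i (Function.update x i s) (by rwa [e2]) (by rwa [e3])
      rw [e2, e3, hg2, hg3] at this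
      refine this.trans ?_
      push_cast
      ring
    rw [partialDeriv, h]
    exact (hd.const_mul _).deriv
  -- the radial flux
  have hrad : partialDeriv 2 (fun y => ((Real.sqrt |(metric Q₁ Q₂ Rz y).det| : ℝ) : ℂ) *
        ∑ j, (((metric Q₁ Q₂ Rz y)⁻¹ 2 j : ℝ) : ℂ) * partialDeriv j u y) x =
      ((x 2 * ((Λ - (ω ^ 2 - lam ^ 2) * (x 2 ^ 2 + (Q₁ + Q₂)) -
        rot Q₁ Q₂ Rz ^ 2 * (ω * Rz - m) ^ 2 / (x 2 ^ 2 + rot Q₁ Q₂ Rz ^ 2) +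
        rot Q₁ Q₂ Rz ^ 2 * (lam * Rz) ^ 2 / x 2 ^ 2) * ur (x 2)) : ℝ) : ℂ) *
        (phase ω lam m x * ((Real.sin (x 3) * Real.cos (x 3) * uθ (x 3) : ℝ) : ℂ)) := by
    have h : (fun s => (fun y => ((Real.sqrt |(metric Q₁ Q₂ Rz y).det| : ℝ) : ℂ) *
        ∑ j, (((metric Q₁ Q₂ Rz y)⁻¹ 2 j : ℝ) : ℂ) * partialDeriv j u y)
        (Function.update x 2 s)) =ᶠ[𝓝 (x 2)] fun s =>
        ((s * (s ^ 2 + rot Q₁ Q₂ Rz ^ 2) * deriv ur s : ℝ) : ℂ) *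
        (phase ω lam m x * ((Real.sin (x 3) * Real.cos (x 3) * uθ (x 3) : ℝ) : ℂ)) := by
      filter_upwards [isOpen_Ioi.mem_nhds hr] with s hs'
      have e2 : Function.update x 2 s 2 = s := Function.update_self ..
      have e3 : Function.update x 2 s 3 = x 3 := Function.update_of_ne (by decide) _ _
      have := hflux 2 (Function.update x 2 s) (by rwa [e2]) (by rwa [e3])
      have hp : phase ω lam m (Function.update x 2 s) = phase ω lam m x := by
        simp [phase, Function.update]
      rw [e2, e3, hp] at this
      refine this.trans ?_
      have hf' := (fFun_pos (Q₁ := Q₁) (Q₂ := Q₂) (Rz := Rz) (θ := x 3) hs').ne'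
      have hh' := (hFun_pos (Rz := Rz) (θ := x 3) hQ₁ hQ₂ hs').ne'
      have hg : D s (x 3) * g s (x 3) 2 2 =
          s * (s ^ 2 + rot Q₁ Q₂ Rz ^ 2) * (Real.sin (x 3) * Real.cos (x 3)) := by
        simp only [D, g, volDensity, invMetric, Matrix.of_apply, Matrix.cons_val', Matrix.cons_val]
        field_simp
      have g0 : g s (x 3) 2 0 = 0 := rfl
      have g1 : g s (x 3) 2 1 = 0 := rfl
      have g3 : g s (x 3) 2 3 = 0 := rfl
      have g4 : g s (x 3) 2 4 = 0 := rfl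
      have hg' := congrArg (fun t : ℝ => (t : ℂ)) hg
      rw [g0, g1, g3, g4]
      push_cast at hg' ⊢
      linear_combination (phase ω lam m x * ((deriv ur s : ℝ) : ℂ) * (uθ (x 3) : ℂ)) * hg'
    rw [partialDeriv, h.deriv_eq]
    exact (hodeᵣ.ofReal_comp.mul_const _).deriv
  -- the polar flux
  have hpol : partialDeriv 3 (fun y => ((Real.sqrt |(metric Q₁ Q₂ Rz y).det| : ℝ) : ℂ) *
        ∑ j, (((metric Q₁ Q₂ Rz y)⁻¹ 3 j : ℝ) : ℂ) * partialDeriv j u y) x =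
      ((Real.sin (2 * x 3) * (((m : ℝ) ^ 2 / Real.sin (x 3) ^ 2 +
        (lam ^ 2 - ω ^ 2) * rot Q₁ Q₂ Rz ^ 2 * Real.cos (x 3) ^ 2 - Λ) * uθ (x 3)) : ℝ) : ℂ) *
        (phase ω lam m x * ((x 2 / 2 * ur (x 2) : ℝ) : ℂ)) := by
    have h : (fun s => (fun y => ((Real.sqrt |(metric Q₁ Q₂ Rz y).det| : ℝ) : ℂ) *
        ∑ j, (((metric Q₁ Q₂ Rz y)⁻¹ 3 j : ℝ) : ℂ) * partialDeriv j u y)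
        (Function.update x 3 s)) =ᶠ[𝓝 (x 3)] fun s =>
        ((Real.sin (2 * s) * deriv uθ s : ℝ) : ℂ) *
        (phase ω lam m x * ((x 2 / 2 * ur (x 2) : ℝ) : ℂ)) := by
      filter_upwards [isOpen_Ioo.mem_nhds hθ] with s hs'
      have e2 : Function.update x 3 s 2 = x 2 := Function.update_of_ne (by decide) _ _
      have e3 : Function.update x 3 s 3 = s := Function.update_self ..
      have := hflux 3 (Function.update x 3 s) (by rwa [e2]) (by rwa [e3])
      have hp : phase ω lam m (Function.update x 3 s) = phase ω lam m x := by
        simp [phase, Function.update]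
      rw [e2, e3, hp] at this
      refine this.trans ?_
      have hf' := (fFun_pos (Q₁ := Q₁) (Q₂ := Q₂) (Rz := Rz) (θ := s) hr).ne'
      have hh' := (hFun_pos (Rz := Rz) (θ := s) hQ₁ hQ₂ hr).ne'
      have hg : D (x 2) s * g (x 2) s 3 3 = x 2 / 2 * Real.sin (2 * s) := by
        simp only [D, g, volDensity, invMetric, Matrix.of_apply, Matrix.cons_val', Matrix.cons_val,
          Real.sin_two_mul]
        field_simp
      have g0 : g (x 2) s 3 0 = 0 := rfl
      have g1 : g (x 2) s 3 1 = 0 := rfl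
      have g2 : g (x 2) s 3 2 = 0 := rfl
      have g4 : g (x 2) s 3 4 = 0 := rfl
      have hg' := congrArg (fun t : ℝ => (t : ℂ)) hg
      rw [g0, g1, g2, g4]
      push_cast at hg' ⊢
      linear_combination (phase ω lam m x * (ur (x 2) : ℂ) * ((deriv uθ s : ℝ) : ℂ)) * hg'
    rw [partialDeriv, h.deriv_eq]
    exact (hodeθ.ofReal_comp.mul_const _).deriv
  rw [waveOp, Fin.sum_univ_six, hrad, hpol,
    hcyc 0 _ (by decide) (by decide) rfl rfl (hasDerivAt_mode_t x),
    hcyc 1 _ (by decide) (by decide) rfl rfl (hasDerivAt_mode_z x),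
    hcyc 4 _ (by decide) (by decide) rfl rfl (hasDerivAt_mode_φ x),
    hcyc 5 _ (by decide) (by decide) rfl rfl (hasDerivAt_mode_ψ x)]
  refine mul_eq_zero_of_right _ ?_
  have key := symbol_separates (ω := ω) (lam := lam) (m := m) hQ₁ hQ₂ hRz hr hθ
  have g01 : g (x 2) (x 3) 0 1 = 0 := rfl
  have g10 : g (x 2) (x 3) 1 0 = 0 := rfl
  have g14 : g (x 2) (x 3) 1 4 = 0 := rfl
  have g41 : g (x 2) (x 3) 4 1 = 0 := rfl
  have g40 : g (x 2) (x 3) 4 0 = g (x 2) (x 3) 0 4 := rfl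
  have hD : D (x 2) (x 3) = x 2 * Real.sin (x 3) * Real.cos (x 3) *
      (hFun Q₁ Q₂ Rz (x 2) (x 3) * fFun Q₁ Q₂ Rz (x 2) (x 3)) := rfl
  rw [g01, g10, g14, g41, g40, hD, mode_eq_phase, Real.sin_two_mul]
  have key' := congrArg (fun t : ℝ => (t : ℂ)) key
  change (((_ * _) * (ω ^ 2 * g (x 2) (x 3) 0 0 - 2 * ω * m * g (x 2) (x 3) 0 4 +
    m ^ 2 * g (x 2) (x 3) 4 4 + lam ^ 2 * g (x 2) (x 3) 1 1) : ℝ) : ℂ) = _ at key'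
  generalize g (x 2) (x 3) 0 0 = g00 at *
  generalize g (x 2) (x 3) 0 4 = g04 at *
  generalize g (x 2) (x 3) 4 4 = g44 at *
  generalize g (x 2) (x 3) 1 1 = g11 at *
  push_cast at key' ⊢
  linear_combination (phase ω lam m x * (ur (x 2) : ℂ) * (uθ (x 3) : ℂ) * (x 2 : ℂ) *
    Complex.sin (x 3) * Complex.cos (x 3)) * ((hFun Q₁ Q₂ Rz (x 2) (x 3) : ℂ) *
    (fFun Q₁ Q₂ Rz (x 2) (x 3) : ℂ) * ((ω : ℂ) ^ 2 * (g00 : ℂ) - 2 * (ω : ℂ) * (m : ℂ) * (g04 : ℂ) +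
    (m : ℂ) ^ 2 * (g44 : ℂ) + (lam : ℂ) ^ 2 * (g11 : ℂ)) * Complex.I_sq - key')

end

/-! ### The radial function and regularity of the modes -/

/-- The radial function `r^k w(r²)`. -/
noncomputable def radialMode (k : ℕ) (w : ℝ → ℝ) (r : ℝ) : ℝ := r ^ k * w (r ^ 2)

theorem hasDerivAt_radialMode {k : ℕ} {w : ℝ → ℝ}
    (hw : ContDiff ℝ ((⊤ : ℕ∞) : WithTop ℕ∞) w) {r : ℝ} (hr : r ≠ 0) :
    HasDerivAt (radialMode k w) (r ^ k * (k / r * w (r ^ 2) + 2 * r * deriv w (r ^ 2))) r := by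
  have h1 := hasDerivAt_pow_of_ne_zero (hasDerivAt_id r) hr k
  have h2 : HasDerivAt (fun r : ℝ => r ^ 2) (2 * r) r := by simpa using hasDerivAt_pow 2 r
  have h3 := (hasDerivAt_deriv_of_contDiff hw (r ^ 2)).comp r h2
  refine (h1.mul h3).congr_deriv ?_
  simp only [Function.comp, id]
  ring

/-- The radial equation in the variable `r`, from the equation for the profile `w` in the variable
`s = r²`. -/
theorem hasDerivAt_radial_flux {a Rz Q lam ω Λ : ℝ} (ha : 0 < a) {k ℓ : ℕ} {w : ℝ → ℝ}
    (hk : (lam * Rz) ^ 2 = (k : ℝ) ^ 2) (hw : ContDiff ℝ ((⊤ : ℕ∞) : WithTop ℕ∞) w) {r : ℝ}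
    (hr : 0 < r)
    (hode : HasDerivAt (fun s => s ^ (k + 1) * (s + a ^ 2) * deriv w s)
      ((r ^ 2) ^ k * (radialCoeff a Rz Q lam ω Λ (1 / (r ^ 2 + a ^ 2)) k ℓ (r ^ 2) / 4 *
        w (r ^ 2))) (r ^ 2)) :
    HasDerivAt (fun r => r * (r ^ 2 + a ^ 2) * deriv (radialMode k w) r)
      (r * ((Λ - (ω ^ 2 - lam ^ 2) * (r ^ 2 + Q) - a ^ 2 * (ω * Rz + ℓ) ^ 2 / (r ^ 2 + a ^ 2) +
        a ^ 2 * (lam * Rz) ^ 2 / r ^ 2) * radialMode k w r)) r := by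
  have h1 : HasDerivAt (fun r : ℝ => r ^ k) (k * r ^ k * (1 / r)) r :=
    hasDerivAt_pow_of_ne_zero (hasDerivAt_id r) hr.ne' k
  have h2 : HasDerivAt (fun r : ℝ => r ^ 2) (2 * r) r := by simpa using hasDerivAt_pow 2 r
  have h3 : HasDerivAt (fun r => w (r ^ 2)) (deriv w (r ^ 2) * (2 * r)) r :=
    (hasDerivAt_deriv_of_contDiff hw (r ^ 2)).comp r h2
  have h4 : HasDerivAt (fun r => (r ^ 2) ^ (k + 1) * (r ^ 2 + a ^ 2) * deriv w (r ^ 2)) (_ * (2 * r))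
      r := HasDerivAt.comp (h₂ := fun s => s ^ (k + 1) * (s + a ^ 2) * deriv w s) r hode h2
  have h5 := (((h2.add_const (a ^ 2)).const_mul (k : ℝ)).mul (h1.mul h3)).add
    ((h4.const_mul 2).div h1 (pow_ne_zero k hr.ne'))
  have hpow : ∀ z : ℝ, (z ^ 2) ^ k = (z ^ k) ^ 2 := fun z => by
    rw [← pow_mul, ← pow_mul, mul_comm]
  refine (h5.congr_of_eventuallyEq ?_).congr_deriv ?_
  · filter_upwards [isOpen_Ioi.mem_nhds hr] with z hz
    have hz' : z ≠ 0 := ne_of_gt hz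
    have hzk := pow_ne_zero k hz'
    rw [(hasDerivAt_radialMode hw hz').deriv]
    simp only [Pi.add_apply, Pi.mul_apply, Pi.div_apply, pow_succ (z ^ 2) k, hpow]
    generalize z ^ k = X at *
    field_simp
  · have hrk := pow_ne_zero k hr.ne'
    have hP : r ^ 2 + a ^ 2 ≠ 0 := by positivity
    rw [hk]
    simp only [Pi.mul_apply, radialMode, radialCoeff, pow_succ (r ^ 2) k, hpow]
    generalize r ^ k = X at *
    field_simp
    ring

/-- The factor `r^|n| e^{i n α}` of a mode, as a smooth function of `r e^{iα} ∈ ℂ`. -/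
noncomputable def windingPow (n : ℤ) (z : ℂ) : ℂ :=
  if 0 ≤ n then z ^ n.natAbs else (starRingEnd ℂ z) ^ n.natAbs

theorem contDiff_windingPow (n : ℤ) : ContDiff ℝ ((⊤ : ℕ∞) : WithTop ℕ∞) (windingPow n) := by
  by_cases h : 0 ≤ n
  · simp only [funext fun z => show windingPow n z = z ^ n.natAbs by simp [windingPow, h]]
    fun_prop
  · simp only [funext fun z => show windingPow n z = (starRingEnd ℂ z) ^ n.natAbs by
      simp [windingPow, h]]
    exact Complex.conjCLE.contDiff.pow _

theorem windingPow_polar (n : ℤ) (r α : ℝ) :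
    windingPow n ((r : ℂ) * Complex.exp (Complex.I * (α : ℂ))) =
      (r : ℂ) ^ n.natAbs * Complex.exp (Complex.I * ((n * α : ℝ) : ℂ)) := by
  unfold windingPow
  split_ifs with h
  · have hn : ((n.natAbs : ℕ) : ℂ) = ((n : ℝ) : ℂ) := by
      rw [← Int.cast_natCast, Int.natAbs_of_nonneg h, Complex.ofReal_intCast]
    rw [mul_pow, ← Complex.exp_nat_mul, hn]
    push_cast
    ring_nf
  · have hn : ((n.natAbs : ℕ) : ℂ) = -((n : ℝ) : ℂ) := by
      rw [← Int.cast_natCast, Int.ofNat_natAbs_of_nonpos (le_of_not_ge h), Int.cast_neg,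
        Complex.ofReal_intCast]
    rw [map_mul, Complex.conj_ofReal, ← Complex.exp_conj, map_mul, Complex.conj_I,
      Complex.conj_ofReal, mul_pow, ← Complex.exp_nat_mul, hn]
    push_cast
    ring_nf

/-- A mode with profiles smooth in `r²` and `cos² θ` is smooth on the spacetime manifold: it is
`e^{-iωt} Z^n w(|Z|²) (conj W₁)^ℓ y(|W₂|²)` in the global coordinates `(t, Z, W₁, W₂)`, where
`n = λ R_z`. -/
theorem regularUpTo_mode {Rz r₁ ω lam κ δ : ℝ} {n : ℤ} {ℓ : ℕ} {w y : ℝ → ℝ} (hRz : 0 < Rz)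
    (hn : lam * Rz = n) (hw : ContDiff ℝ ((⊤ : ℕ∞) : WithTop ℕ∞) w)
    (hy : IsAngularProfile ℓ κ δ y) :
    RegularUpTo Rz r₁ (mode ω lam (-(ℓ : ℤ)) 0 (radialMode n.natAbs w) (angularMode ℓ y)) := by
  refine ⟨fun Z => Complex.exp (Complex.I * ((-ω * Z.1 : ℝ) : ℂ)) *
    (windingPow n Z.2.1 * ((w (‖Z.2.1‖ ^ 2) : ℝ) : ℂ)) *
    ((starRingEnd ℂ Z.2.2.1) ^ ℓ * ((y (‖Z.2.2.2‖ ^ 2) : ℝ) : ℂ)), ?_, fun x _ _ _ _ => ?_⟩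
  · refine (ContDiff.mul ?_ (ContDiff.mul ?_ ?_)).mul
      (hy.contDiff_hopfMode.comp (contDiff_snd.comp contDiff_snd))
    · refine (contDiff_const.mul (Complex.ofRealCLM.contDiff.comp ?_)).cexp
      exact contDiff_const.mul contDiff_fst
    · exact (contDiff_windingPow n).comp (contDiff_fst.comp contDiff_snd)
    · refine Complex.ofRealCLM.contDiff.comp (hw.comp ?_)
      exact (contDiff_norm_sq ℝ).comp (contDiff_fst.comp contDiff_snd)
  · have h1 : ‖(x 2 : ℂ) * Complex.exp (Complex.I * ((x 1 / Rz : ℝ) : ℂ))‖ ^ 2 = x 2 ^ 2 := by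
      rw [norm_mul, mul_comm Complex.I, Complex.norm_exp_ofReal_mul_I, mul_one,
        Complex.norm_real, Real.norm_eq_abs, sq_abs]
    have h2 : (n : ℝ) * (x 1 / Rz) = lam * x 1 := by rw [← hn]; field_simp
    simp only [globalCoord]
    rw [IsAngularProfile.hopfMode_eq, windingPow_polar, h1, h2, mode_eq_phase, phase, radialMode]
    have h3 : (((-(ω * x 0) + lam * x 1 + ((-(ℓ : ℤ) : ℤ) : ℝ) * x 4 : ℝ)) : ℂ) =
        ((-ω * x 0 : ℝ) : ℂ) + ((lam * x 1 : ℝ) : ℂ) + (((((-(ℓ : ℤ) : ℤ) : ℝ) * x 4 : ℝ)) : ℂ) := by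
      push_cast
      ring
    rw [h3, mul_add, mul_add, Complex.exp_add, Complex.exp_add]
    push_cast
    ring

/-! ### Quasimodes -/

/-- The lowest angular eigenvalue, as a continuous function of the frequency in `[0, ω₀]` (held
constant outside this interval), with its positive eigenfunctions. -/
theorem exists_continuous_angular_branch (Q₁ Q₂ Rz lam : ℝ) {ω₀ : ℝ} (hω₀ : 0 ≤ ω₀) :
    ∃ K : ℝ, 0 ≤ K ∧ ∃ ℓ₀ : ℕ, ∀ ℓ : ℕ, ℓ₀ ≤ ℓ → ∃ δ : ℝ → ℝ, ∃ y : ℝ → ℝ → ℝ,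
      Continuous δ ∧ (∀ ω, |δ ω| ≤ K) ∧ ∀ ω ∈ Icc 0 ω₀,
        IsAngularProfile ℓ ((lam ^ 2 - ω ^ 2) * (rot Q₁ Q₂ Rz) ^ 2) (δ ω) (y ω) := by
  set a := rot Q₁ Q₂ Rz
  let c : ℝ → ℝ := fun ω => projIcc 0 ω₀ hω₀ ω
  have hc : Continuous c := continuous_subtype_val.comp continuous_projIcc
  have hc0 : ∀ ω, 0 ≤ c ω ∧ c ω ≤ ω₀ := fun ω => (projIcc 0 ω₀ hω₀ ω).2
  let κ : ℝ → ℝ := fun ω => (lam ^ 2 - c ω ^ 2) * a ^ 2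
  have hκc : Continuous κ := by fun_prop
  have hK : 0 ≤ (lam ^ 2 + ω₀ ^ 2) * a ^ 2 := by positivity
  have hκ : ∀ ω, |κ ω| ≤ (lam ^ 2 + ω₀ ^ 2) * a ^ 2 := by
    intro ω
    rw [abs_mul, abs_of_nonneg (sq_nonneg a)]
    refine mul_le_mul_of_nonneg_right ?_ (sq_nonneg a)
    have h1 : c ω ^ 2 ≤ ω₀ ^ 2 := pow_le_pow_left₀ (hc0 ω).1 (hc0 ω).2 2
    rw [abs_le]
    constructor <;> nlinarith [sq_nonneg lam, sq_nonneg (c ω)]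
  obtain ⟨ℓ₀, h⟩ := exists_isAngularProfile _ hK
  refine ⟨_, hK, ℓ₀ + 1, fun ℓ hℓ => ?_⟩
  choose δ y hδ hy using fun ω => h ℓ (by omega) (κ ω) (hκ ω)
  refine ⟨δ, y, ?_, fun ω => (hδ ω).trans (hκ ω), fun ω hω => ?_⟩
  · have hlip : ∀ ω ω', dist (δ ω) (δ ω') ≤ dist (κ ω) (κ ω') := by
      intro ω ω'
      have h1 := (hy ω).sub_le_of_isAngularProfile (by omega) (hy ω')
      have h2 := (hy ω').sub_le_of_isAngularProfile (by omega) (hy ω)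
      rw [Real.dist_eq, Real.dist_eq, abs_le]
      change δ ω' - δ ω ≤ |κ ω' - κ ω| at h2
      rw [abs_sub_comm] at h2
      exact ⟨by linarith, h1⟩
    rw [continuous_iff_continuousAt]
    intro ω
    rw [ContinuousAt, tendsto_iff_dist_tendsto_zero]
    exact squeeze_zero (fun _ => dist_nonneg) (fun ω' => hlip ω' ω)
      (tendsto_iff_dist_tendsto_zero.1 hκc.continuousAt)
  · have h1 := hy ω
    have h2 : c ω = ω := by simp only [c, projIcc_of_mem hω₀ hω]
    simp only [κ, h2] at h1
    exact h1

end Microstate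

open Microstate

theorem mainTheorem4 (Q₁ Q₂ Rz : ℝ) (hQ₁ : 0 < Q₁) (hQ₂ : 0 < Q₂) (hRz : 0 < Rz)
    (lam : ℝ) (hlam : ∃ k : ℤ, lam * Rz = k) :
    ∃ ω₀ C : ℝ, ∀ ωmax : ℝ, ω₀ ≤ ωmax → ∀ R : ℝ, 0 < R → ∃ ℓ₀ : ℕ, ∀ ℓ : ℕ, ℓ₀ ≤ ℓ →
      ∃ (ω μ : ℝ) (ur uθ : ℝ → ℝ),
        |ω| ≤ ωmax ∧
        0 < μ ∧
        Microstate.IsAngularEigenvalue Q₁ Q₂ Rz lam ω ℓ (μ ^ 2) ∧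
        Microstate.IsAngularEigenfunction Q₁ Q₂ Rz lam ω (-(ℓ : ℤ)) (μ ^ 2) uθ ∧
        |(ℓ : ℝ) - (μ - 1)| ≤ C / μ ∧
        Microstate.IsDirichletMode Q₁ Q₂ Rz (R * μ) ω lam (-(ℓ : ℤ)) 0 ur uθ := by
  obtain ⟨n, hn⟩ := hlam
  have ha := rot_pos hQ₁ hQ₂ hRz
  have hk : (lam * Rz) ^ 2 = ((n.natAbs : ℕ) : ℝ) ^ 2 := by
    rw [hn, Nat.cast_natAbs, Int.cast_abs, sq_abs]
  obtain ⟨ω₀, hω₀, hrad⟩ := exists_radial_dirichlet (Q := Q₁ + Q₂) ha hRz (by positivity) lam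
    n.natAbs
  obtain ⟨K, hK, ℓ₁, hang⟩ := exists_continuous_angular_branch Q₁ Q₂ Rz lam hω₀
  refine ⟨ω₀, 1 + K, fun ωmax hωmax R hR => ?_⟩
  obtain ⟨ℓ₂, hrad⟩ := hrad K R hR
  obtain ⟨ℓ₃, hℓ₃⟩ := exists_nat_gt K
  refine ⟨ℓ₁ + ℓ₂ + ℓ₃ + 1, fun ℓ hℓ => ?_⟩
  obtain ⟨δ, y, hδc, hδ, hy⟩ := hang ℓ (by omega)
  obtain ⟨ω, hω, w, hw, hw0, hwR, hode⟩ := hrad ℓ (by omega) δ hδc hδ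
  have hyω := hy ω hω
  have hδω := abs_le.mp (hδ ω)
  have hℓK : K < ℓ := hℓ₃.trans_le (by exact_mod_cast (by omega : ℓ₃ ≤ ℓ))
  have hℓ0 : (0 : ℝ) ≤ ℓ := Nat.cast_nonneg ℓ
  have hΛ : 0 < (ℓ : ℝ) * (ℓ + 2) + δ ω := by nlinarith
  set Λ := (ℓ : ℝ) * (ℓ + 2) + δ ω with hΛ_def
  set μ := Real.sqrt Λ with hμ_def
  have hμ : 0 < μ := Real.sqrt_pos.2 hΛ
  have hμ2 : μ ^ 2 = Λ := Real.sq_sqrt hΛ.le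
  have hRμ : 0 < R * μ := mul_pos hR hμ
  have hRμ2 : (R * μ) ^ 2 = R ^ 2 * Λ := by rw [mul_pow, hμ2]
  have hur : Differentiable ℝ (radialMode n.natAbs w) := by
    have h1 := hw.differentiable (by simp)
    unfold radialMode
    fun_prop
  have huθ : Differentiable ℝ (angularMode ℓ (y ω)) := by
    have h1 := hyω.contDiff.differentiable (by simp)
    unfold angularMode
    fun_prop
  refine ⟨ω, μ, radialMode n.natAbs w, angularMode ℓ (y ω), ?_, hμ, ?_, ?_, ?_, ?_⟩
  · rw [abs_of_nonneg hω.1]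
    exact hω.2.trans hωmax
  · rw [hμ2]
    exact hyω.isAngularEigenvalue (by omega)
  · rw [hμ2]
    exact hyω.isAngularEigenfunction
  · -- `(ℓ + 1 - μ) (ℓ + 1 + μ) = (ℓ + 1)² - Λ = 1 - δ`
    have h1 : ((ℓ : ℝ) - (μ - 1)) * (ℓ + 1 + μ) = 1 - δ ω := by
      have : μ ^ 2 = ℓ * (ℓ + 2) + δ ω := hμ2
      linear_combination -this
    have h2 : |(ℓ : ℝ) - (μ - 1)| * (ℓ + 1 + μ) ≤ 1 + K := by
      rw [← abs_of_pos (by positivity : 0 < (ℓ : ℝ) + 1 + μ), ← abs_mul, h1, abs_le]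
      constructor <;> linarith
    rw [le_div_iff₀ hμ]
    exact (mul_le_mul_of_nonneg_left (by linarith) (abs_nonneg _)).trans h2
  · refine ⟨?_, hyω.isAngularEigenfunction.1, regularUpTo_mode hRz hn hw hyω, ?_, ?_⟩
    · have h1 : ContinuousAt (fun r : ℝ => w (r ^ 2)) 0 := by
        have := hw.continuous
        fun_prop
      have h2 : ∀ᶠ r in 𝓝[>] (0 : ℝ), w (r ^ 2) ≠ 0 :=
        (h1.eventually_ne (by simp [hw0])).filter_mono nhdsWithin_le_nhds
      obtain ⟨r, hr, hr'⟩ := (h2.and (Ioo_mem_nhdsGT hRμ)).exists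
      exact ⟨r, hr', mul_ne_zero (pow_ne_zero _ hr'.1.ne') hr⟩
    · intro x hx2 hx2' hx3 hx3'
      have hs : x 2 ^ 2 ∈ Ioo 0 (R ^ 2 * Λ) := by
        rw [← hRμ2]
        exact ⟨by positivity, pow_lt_pow_left₀ hx2' hx2.le two_ne_zero⟩
      refine waveOp_mode_eq_zero (Λ := Λ) hQ₁ hQ₂ hRz hur huθ hx2 ⟨hx3, hx3'⟩ ?_ ?_
      · refine (hasDerivAt_radial_flux ha hk hw hx2 (hode _ hs)).congr_deriv ?_
        push_cast
        rw [sub_neg_eq_add]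
      · refine (hyω.hasDerivAt_sin_two_mul_mul_deriv ⟨hx3, hx3'⟩).congr_deriv ?_
        push_cast
        rw [neg_sq]
    · rw [radialMode, hRμ2, hwR, mul_zero]
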